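/- **Theorem (Sub-Exponential Case).** For $x=(x_1,\dots,x_n)^T$ and $y=(y_1,\dots,y_n)^T$ in $\mathbb{R}^n$, with means $\bar x=\frac1n\sum_k x_k$ and $\bar y=\frac1n\sum_k y_k$, let $$\rho_{x,y}=\frac{\sum_{k=1}^n (x_k-\bar x)(y_k-\bar y)}{\sqrt{\sum_{k=1}^n (x_k-\bar x)^2\cdot\sum_{k=1}^n (y_k-\bar y)^2}}$$ be the Pearson correlation coefficient. A random vector $Y$ in $\mathbb{R}^n$ is said to have a spherical distribution if $OY$ and $Y$ have the same distribution for every $n\times n$ orthogonal matrix $O$. For every $n\ge 1$ let $p=p_n\ge 2$ be an integer and let $X_1,\dots,X_p$ (depending on $n$) be independent random vectors in $\mathbb{R}^n$ with a common spherical distribution, which may depend on $n$, such that $P(X_1=0)=0$. Let $$L_n=\max_{1\le i<j\le p}|\rho_{X_i,X_j}|$$ be the coherence of the random matrix with columns $X_1,\dots,X_p$. Suppose that $(\log p_n)/n\to 0$ as $n\to\infty$. Then: (i) $L_n\to 0$ in probability as $n\to\infty$. (ii) If moreover $p_n\to\infty$, then, with $T_n=\log(1-L_n^2)$, the random variables $$nT_n+4\log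 p_n-\log\log p_n$$ converge weakly, as $n\to\infty$, to a probability distribution on $\mathbb{R}$ with distribution function $F(y)=1-e^{-Ke^{y/2}}$, $y\in\mathbb{R}$, where $K=1/\sqrt{8\pi}$. -/

import Mathlib

open MeasureTheory ProbabilityTheory Filter Topology

noncomputable section

/-- The arithmetic mean of the coordinates of `x`. -/
def coordMean {n : ℕ} (x : Fin n → ℝ) : ℝ :=
  (∑ k, x k) / n

/-- The Pearson correlation coefficient of the vectors `x` and `y`. -/
def pearson {n : ℕ} (x y : Fin n → ℝ) : ℝ :=
  (∑ k, (x k - coordMean x) * (y k - coordMean y)) /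
    √((∑ k, (x k - coordMean x) ^ 2) * ∑ k, (y k - coordMean y) ^ 2)

/-- The coherence of the matrix with columns `x 0, …, x (p - 1)`: the maximum of
`|ρ i j|` over all pairs `i < j` (a finite, nonempty family as soon as `2 ≤ p`). -/
def coherence {n p : ℕ} (x : Fin p → Fin n → ℝ) : ℝ :=
  ⨆ q : {q : Fin p × Fin p // q.1 < q.2}, |pearson (x q.1.1) (x q.1.2)|

/-- `Y` has a spherical distribution: `O Y` and `Y` have the same law for every
orthogonal matrix `O`. -/
def IsSpherical {Ω : Type*} [MeasurableSpace Ω] (P : Measure Ω) {n : ℕ}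
    (Y : Ω → Fin n → ℝ) : Prop :=
  ∀ O ∈ Matrix.orthogonalGroup (Fin n) ℝ,
    IdentDistrib (fun ω => O.mulVec (Y ω)) Y P P

/-- The columns `X j` are independent random vectors with a common spherical
distribution that has no atom at the origin. -/
structure IIDSphericalColumns {Ω : Type*} [MeasurableSpace Ω] (P : Measure Ω) {n p : ℕ}
    (X : Fin p → Ω → Fin n → ℝ) : Prop where
  measurable : ∀ j, Measurable (X j)
  indep : iIndepFun X P
  identDistrib : ∀ i j, IdentDistrib (X i) (X j) P P
  spherical : ∀ j, IsSpherical P (X j)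
  no_atom : ∀ j, P {ω | X j ω = 0} = 0

end

/-! Centring is the orthogonal projection onto the hyperplane orthogonal to the all-ones vector, and
|ρ| is the absolute cosine of the angle between centred vectors (`abs_pearson`). Centred columns are
almost surely nonzero and their law is invariant under reflections. Hence, given one column, the
probability q = `corrTail n t` that another one has |cos| ≥ t with it depends neither on the given
column nor on the law. It may be computed for the uniform law on a ball, where the cotangent of the
angle has density proportional to (1 + s²)^(-(n-1)/2) (`ReflectionInvariant.measure_le_absCos`).

Since this conditional probability is constant, the events of two distinct pairs sharing an index
are still independent. Each pair has at most 4p neighbours, so the Chen–Stein bound gives |P(L < t)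
- exp(-C(p,2) q)| ≤ 8p³q² (`abs_measureReal_no_pair_sub_exp_le`).

Put t² = 1 - e^(-s). If s → 0 and ns → ∞, then q ~ √(2/π) e^(-ns/2) / √(ns) (`tendsto_corrTail`).
The choice ns = 4 log p - log log p - y makes p²q tend to 2K e^(y/2), so the error is O(1/p) and P(L
< t) → exp(-K e^(y/2)); log p = o(n) ensures s → 0. For (i) the union bound p²q is enough: at a
fixed level q decays exponentially in n, whereas p² = e^(o(n)). -/

/-! ### Poisson approximation by the Chen–Stein method -/

/-- Solution of the Stein equation for the Poisson law and the event `{0}`. -/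
lemma exists_stein_solution (l : ℝ) (hl : 0 ≤ l) :
    ∃ f : ℕ → ℝ, (∀ j, 0 ≤ f j ∧ f j ≤ 1) ∧
      ∀ j : ℕ, (if j = 0 then 1 else 0) - Real.exp (-l) = l * f (j + 1) - j * f j := by
  -- The equation is integration by parts for this integral. At j = 0 the truncated exponent j - 1
  -- is harmless, because f 0 only occurs multiplied by j.
  refine ⟨fun j => ∫ s in (0 : ℝ)..1, s ^ (j - 1) * Real.exp (-l * s), fun j => ⟨?_, ?_⟩,
    fun j => ?_⟩
  · exact intervalIntegral.integral_nonneg zero_le_one fun s hs =>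
      mul_nonneg (pow_nonneg hs.1 _) (Real.exp_pos _).le
  · have : ∫ s in (0 : ℝ)..1, s ^ (j - 1) * Real.exp (-l * s) ≤ ∫ s in (0 : ℝ)..1, (1 : ℝ) := by
      refine intervalIntegral.integral_mono_on zero_le_one
        (Continuous.intervalIntegrable (by fun_prop) _ _) (by simp) fun s hs => ?_
      refine mul_le_one₀ (pow_le_one₀ hs.1 hs.2) (Real.exp_pos _).le ?_
      rw [Real.exp_le_one_iff]
      nlinarith [hs.1, mul_nonneg hl hs.1]
    simpa using this
  · have key := intervalIntegral.integral_mul_deriv_eq_deriv_mul (a := (0 : ℝ)) (b := 1)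
      (u := fun s => s ^ j) (u' := fun s => j * s ^ (j - 1))
      (v := fun s => -Real.exp (-l * s)) (v' := fun s => l * Real.exp (-l * s))
      (fun s _ => by simpa using hasDerivAt_pow j s)
      (fun s _ => by
        have := ((hasDerivAt_id s).const_mul (-l)).exp.neg
        refine this.congr_deriv ?_
        simp; ring)
      (Continuous.intervalIntegrable (by fun_prop) _ _)
      (Continuous.intervalIntegrable (by fun_prop) _ _)
    have h1 : ∫ s in (0 : ℝ)..1, s ^ j * (l * Real.exp (-l * s))
        = l * ∫ s in (0 : ℝ)..1, s ^ (j + 1 - 1) * Real.exp (-l * s) := by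
      rw [← intervalIntegral.integral_const_mul]
      congr 1; ext s; simp; ring
    have h2 : ∫ s in (0 : ℝ)..1, (j * s ^ (j - 1)) * -Real.exp (-l * s)
        = -(j * ∫ s in (0 : ℝ)..1, s ^ (j - 1) * Real.exp (-l * s)) := by
      rw [← intervalIntegral.integral_const_mul, ← intervalIntegral.integral_neg]
      congr 1; ext s; ring
    rw [h1, h2] at key
    rcases Nat.eq_zero_or_pos j with rfl | hj
    · simp at key ⊢; linarith
    · simp [hj.ne'] at key ⊢; linarith

set_option maxHeartbeats 1000000 in
open Classical in
/-- Poisson approximation for the probability that none of finitely many locally dependent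
events occurs (Chen–Stein bound). -/
theorem abs_measureReal_none_sub_exp_le {Ω ι : Type*} [MeasurableSpace Ω] [Fintype ι] [DecidableEq ι]
    (P : Measure Ω) [IsProbabilityMeasure P] (A : ι → Set Ω) (hA : ∀ a, MeasurableSet (A a))
    (N : ι → Finset ι) (hN : ∀ a, a ∈ N a)
    (hind : ∀ a, IndepFun ((A a).indicator (fun _ => (1 : ℝ)))
      (fun ω => (Finset.univ.filter fun b => b ∉ N a ∧ ω ∈ A b).card) P) :
    |P.real {ω | ∀ a, ω ∉ A a} - Real.exp (-∑ a, P.real (A a))| ≤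
      ∑ a, ∑ b ∈ N a, P.real (A a) * P.real (A b) +
      ∑ a, ∑ b ∈ (N a).erase a, P.real (A a ∩ A b) := by
  obtain ⟨f, hf, hst⟩ := exists_stein_solution (∑ a, P.real (A a))
    (Finset.sum_nonneg fun _ _ => measureReal_nonneg)
  set l := ∑ a, P.real (A a) with hl
  let x : ι → Ω → ℝ := fun a => (A a).indicator (fun _ => (1 : ℝ))
  let W : Ω → ℕ := fun ω => (Finset.univ.filter fun b => ω ∈ A b).card
  let V : ι → Ω → ℕ := fun a ω => (Finset.univ.filter fun b => b ∉ N a ∧ ω ∈ A b).card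
  have hcard : ∀ Q : ι → Prop, Measurable
      (fun ω => (Finset.univ.filter fun b => Q b ∧ ω ∈ A b).card) := by
    intro Q
    simp only [Finset.card_filter]
    refine Finset.measurable_sum _ fun b _ => ?_
    by_cases hb : Q b
    · simp only [hb, true_and]
      exact Measurable.ite (hA b) measurable_const measurable_const
    · simp [hb]
  have hW : Measurable W := by simpa [W] using hcard fun _ => True
  have hV : ∀ a, Measurable (V a) := fun a => by convert hcard (fun b => b ∉ N a)
  have hx : ∀ a, Measurable (x a) := fun a => measurable_const.indicator (hA a)
  have hx01 : ∀ a ω, 0 ≤ x a ω ∧ x a ω ≤ 1 := fun a ω => by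
    by_cases h : ω ∈ A a <;> simp [x, h]
  have hint : ∀ g : Ω → ℝ, Measurable g → (∀ ω, |g ω| ≤ 1) → Integrable g P := fun g hg hb =>
    Integrable.of_bound hg.aestronglyMeasurable 1 (ae_of_all _ hb)
  have hfm : ∀ U : Ω → ℕ, Measurable U → Measurable fun ω => f (U ω) := fun U hU =>
    (measurable_of_countable f).comp hU
  have hf1 : ∀ j, |f j| ≤ 1 := fun j => abs_le.2 ⟨by linarith [(hf j).1], (hf j).2⟩
  have hxf : ∀ a (U : Ω → ℕ), Measurable U → Integrable (fun ω => x a ω * f (U ω)) P :=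
    fun a U hU => hint _ ((hx a).mul (hfm U hU)) fun ω => by
      rw [abs_mul]
      exact mul_le_one₀ (abs_le.2 ⟨by linarith [(hx01 a ω).1], (hx01 a ω).2⟩) (abs_nonneg _) (hf1 _)
  have hfi : ∀ (U : Ω → ℕ), Measurable U → Integrable (fun ω => f (U ω)) P :=
    fun U hU => hint _ (hfm U hU) fun ω => hf1 _
  have hxi : ∀ a, ∫ ω, x a ω ∂P = P.real (A a) := fun a => by
    simp [x, integral_indicator (hA a)]
  have hxint : ∀ a, Integrable (x a) P := fun a => hint _ (hx a) fun ω =>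
    abs_le.2 ⟨by linarith [(hx01 a ω).1], (hx01 a ω).2⟩
  -- Values in [0, 1] already make f 1-Lipschitz on ℕ, since distinct integers differ by at least 1.
  have hfdiff : ∀ (i j : ℕ), i ≤ j → |f j - f i| ≤ ((j - i : ℕ) : ℝ) := by
    intro i j hij
    rcases hij.eq_or_lt with rfl | h
    · simp
    · have : (1 : ℝ) ≤ ((j - i : ℕ) : ℝ) := by exact_mod_cast Nat.sub_pos_of_lt h
      refine le_trans ?_ this
      exact abs_le.2 ⟨by linarith [(hf j).1, (hf i).2], by linarith [(hf j).2, (hf i).1]⟩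
  have hsumx : ∀ (s : Finset ι) ω, ∑ b ∈ s, x b ω = (s.filter fun b => ω ∈ A b).card := by
    intro s ω
    simp [x, Set.indicator_apply]
  have hWV : ∀ a ω, W ω = V a ω + ((N a).filter fun b => ω ∈ A b).card := by
    intro a ω
    have : (Finset.univ.filter fun b => ω ∈ A b) =
        (Finset.univ.filter fun b => b ∉ N a ∧ ω ∈ A b) ∪ ((N a).filter fun b => ω ∈ A b) := by
      ext b; by_cases hb : b ∈ N a <;> simp [hb]
    simp only [W, V]
    rw [this, Finset.card_union_of_disjoint]
    rw [Finset.disjoint_left]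
    intro b hb hb'
    simp at hb hb'
    exact hb.1 hb'.1
  have hWx : ∀ ω, (W ω : ℝ) = ∑ a, x a ω := fun ω => by rw [hsumx]
  -- The Stein equation evaluated at W and integrated, with both l and W expanded as sums over a.
  have hexp : P.real {ω | ∀ a, ω ∉ A a} - Real.exp (-l)
      = ∑ a, (P.real (A a) * ∫ ω, f (W ω + 1) ∂P - ∫ ω, x a ω * f (W ω) ∂P) := by
    have hset : {ω | ∀ a, ω ∉ A a} = W ⁻¹' {0} := by
      ext ω; simp [W, Finset.filter_eq_empty_iff]
    have h0 : ∫ ω, ((if W ω = 0 then (1 : ℝ) else 0) - Real.exp (-l)) ∂P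
        = P.real {ω | ∀ a, ω ∉ A a} - Real.exp (-l) := by
      rw [integral_sub _ (integrable_const _)]
      · have : (fun ω => if W ω = 0 then (1 : ℝ) else 0)
            = (W ⁻¹' {0}).indicator (fun _ => (1 : ℝ)) := by
          ext ω; simp [Set.indicator_apply]
        rw [this, integral_indicator (hW (measurableSet_singleton 0)), hset]
        simp
      · exact hint _ (Measurable.ite (hW (measurableSet_singleton 0)) measurable_const
          measurable_const) fun ω => by split_ifs <;> simp
    rw [← h0]
    have h1 : ∀ ω, (if W ω = 0 then (1 : ℝ) else 0) - Real.exp (-l)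
        = ∑ a, (P.real (A a) * f (W ω + 1) - x a ω * f (W ω)) := by
      intro ω
      rw [hst, hWx, Finset.sum_sub_distrib, ← Finset.sum_mul, ← Finset.sum_mul]
    simp_rw [h1]
    rw [integral_finsetSum]
    · refine Finset.sum_congr rfl fun a _ => ?_
      rw [integral_sub ((hfi (fun ω => W ω + 1) (hW.add_const 1)).const_mul _) (hxf a W hW),
        integral_const_mul]
    · intro a _
      exact ((hfi (fun ω => W ω + 1) (hW.add_const 1)).const_mul _).sub (hxf a W hW)
  rw [hexp, ← Finset.sum_add_distrib]
  refine (Finset.abs_sum_le_sum_abs _ _).trans (Finset.sum_le_sum fun a _ => ?_)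
  have hindep : ∫ ω, x a ω * f (V a ω + 1) ∂P = P.real (A a) * ∫ ω, f (V a ω + 1) ∂P := by
    have := ((hind a).comp measurable_id (measurable_of_countable fun j : ℕ => f (j + 1)))
    have h2 := this.integral_fun_mul_eq_mul_integral (hx a).aestronglyMeasurable
      (hfm (fun ω => V a ω + 1) ((hV a).add_const 1)).aestronglyMeasurable
    rw [← hxi a]
    exact h2
  have hV1 : Measurable fun ω => V a ω + 1 := (hV a).add_const 1
  have hW1 : Measurable fun ω => W ω + 1 := hW.add_const 1
  -- Insert f (V a + 1): as V a ignores the neighbours of a, the two inserted terms cancel by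
  -- independence.
  have hsplit : P.real (A a) * ∫ ω, f (W ω + 1) ∂P - ∫ ω, x a ω * f (W ω) ∂P
      = P.real (A a) * ∫ ω, (f (W ω + 1) - f (V a ω + 1)) ∂P
        + ∫ ω, (x a ω * f (V a ω + 1) - x a ω * f (W ω)) ∂P := by
    rw [integral_sub (hfi _ hW1) (hfi _ hV1), integral_sub (hxf a _ hV1) (hxf a _ hW), hindep]
    ring
  rw [hsplit]
  refine (abs_add_le _ _).trans (add_le_add ?_ ?_)
  · rw [abs_mul, abs_of_nonneg measureReal_nonneg, ← Finset.mul_sum]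
    refine mul_le_mul_of_nonneg_left ?_ measureReal_nonneg
    calc |∫ ω, (f (W ω + 1) - f (V a ω + 1)) ∂P|
        ≤ ∫ ω, |f (W ω + 1) - f (V a ω + 1)| ∂P := abs_integral_le_integral_abs
      _ ≤ ∫ ω, ∑ b ∈ N a, x b ω ∂P := by
          refine integral_mono ((hfi _ hW1).sub (hfi _ hV1)).abs
            (integrable_finsetSum _ fun b _ => hxint b) fun ω => ?_
          refine (hfdiff _ _ ?_).trans ?_
          · simp [hWV a ω]
          · rw [hsumx]
            simp [hWV a ω]
      _ = ∑ b ∈ N a, P.real (A b) := by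
          rw [integral_finsetSum _ fun b _ => hxint b]
          exact Finset.sum_congr rfl fun b _ => hxi b
  · have hprod : ∀ b, Integrable (fun ω => x a ω * x b ω) P := fun b =>
      hint _ ((hx a).mul (hx b)) fun ω => by
        rw [abs_of_nonneg (mul_nonneg (hx01 a ω).1 (hx01 b ω).1)]
        exact mul_le_one₀ (hx01 a ω).2 (hx01 b ω).1 (hx01 b ω).2
    calc |∫ ω, (x a ω * f (V a ω + 1) - x a ω * f (W ω)) ∂P|
        ≤ ∫ ω, |x a ω * f (V a ω + 1) - x a ω * f (W ω)| ∂P := abs_integral_le_integral_abs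
      _ ≤ ∫ ω, ∑ b ∈ (N a).erase a, x a ω * x b ω ∂P := by
          refine integral_mono ((hxf a _ hV1).sub (hxf a _ hW)).abs
            (integrable_finsetSum _ fun b _ => hprod b) fun ω => ?_
          simp only
          rw [← mul_sub, ← Finset.mul_sum, abs_mul, abs_of_nonneg (hx01 a ω).1]
          by_cases hω : ω ∈ A a
          · refine mul_le_mul_of_nonneg_left ?_ (hx01 a ω).1
            -- On A a the count W includes a itself, so W - (V a + 1) counts only the other
            -- neighbours.
            have hk : ((N a).filter fun b => ω ∈ A b).card
                = (((N a).erase a).filter fun b => ω ∈ A b).card + 1 := by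
              have : (((N a).erase a).filter fun b => ω ∈ A b)
                  = ((N a).filter fun b => ω ∈ A b).erase a := by
                ext b; simp [and_assoc]
              rw [this, Finset.card_erase_add_one]
              simp [hN a, hω]
            rw [abs_sub_comm]
            refine (hfdiff _ _ ?_).trans ?_
            · rw [hWV a ω, hk]; omega
            · rw [hsumx, hWV a ω, hk]
              exact_mod_cast (by omega)
          · simp [x, hω]
      _ = ∑ b ∈ (N a).erase a, P.real (A a ∩ A b) := by
          rw [integral_finsetSum _ fun b _ => hprod b]
          refine Finset.sum_congr rfl fun b _ => ?_
          have : (fun ω => x a ω * x b ω) = (A a ∩ A b).indicator (fun _ => (1 : ℝ)) := by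
            ext ω
            by_cases h1 : ω ∈ A a <;> by_cases h2 : ω ∈ A b <;> simp [x, h1, h2]
          rw [this, integral_indicator ((hA a).inter (hA b))]
          simp

/-! ### Angles under reflection-invariant laws -/

section Sphere

variable {F : Type*} [NormedAddCommGroup F] [InnerProductSpace ℝ F]

/-- The absolute value of the cosine of the angle between two vectors. -/
noncomputable def absCos (x y : F) : ℝ := |inner ℝ x y| / (‖x‖ * ‖y‖)

lemma absCos_nonneg (x y : F) : 0 ≤ absCos x y := by unfold absCos; positivity

lemma absCos_comm (x y : F) : absCos x y = absCos y x := by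
  unfold absCos; rw [real_inner_comm, mul_comm]

lemma absCos_le_one (x y : F) : absCos x y ≤ 1 :=
  div_le_one_of_le₀ (abs_real_inner_le_norm x y) (by positivity)

lemma absCos_smul_left (x y : F) {c : ℝ} (hc : c ≠ 0) : absCos (c • x) y = absCos x y := by
  unfold absCos
  rw [real_inner_smul_left, abs_mul, norm_smul, Real.norm_eq_abs, mul_assoc,
    mul_div_mul_left _ _ (abs_ne_zero.2 hc)]

lemma absCos_map {G : Type*} [NormedAddCommGroup G] [InnerProductSpace ℝ G] (U : F ≃ₗᵢ[ℝ] G)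
    (x y : F) : absCos (U x) (U y) = absCos x y := by
  simp [absCos, U.inner_map_map]

/-- Equality case of Cauchy–Schwarz. Zero vectors are excluded by the hypothesis, as division by
zero makes their `absCos` equal to 0. -/
lemma mem_span_of_one_le_absCos {x y : F} (h : 1 ≤ absCos x y) :
    y ∈ Submodule.span ℝ {x} := by
  have h1 : |inner ℝ x y / (‖x‖ * ‖y‖)| = 1 := by
    rw [abs_div, abs_of_nonneg (show 0 ≤ ‖x‖ * ‖y‖ by positivity)]
    exact le_antisymm (absCos_le_one x y) h
  obtain ⟨_, r, _, rfl⟩ := (abs_real_inner_div_norm_mul_norm_eq_one_iff x y).1 h1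
  exact Submodule.smul_mem _ _ (Submodule.mem_span_singleton_self x)

lemma one_le_absCos_of_mem_span {x y : F} (hy : y ≠ 0) (h : y ∈ Submodule.span ℝ {x}) :
    1 ≤ absCos x y := by
  obtain ⟨r, rfl⟩ := Submodule.mem_span_singleton.1 h
  have hx : x ≠ 0 := fun h => hy (by simp [h])
  have hr : r ≠ 0 := fun h => hy (by simp [h])
  have h1 := (abs_real_inner_div_norm_mul_norm_eq_one_iff x (r • x)).2 ⟨hx, r, hr, rfl⟩
  rw [abs_div, abs_of_nonneg (show 0 ≤ ‖x‖ * ‖r • x‖ by positivity)] at h1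
  exact h1.ge

variable [FiniteDimensional ℝ F] [MeasurableSpace F] [BorelSpace F]

lemma measurable_absCos : Measurable fun z : F × F => absCos z.1 z.2 := by
  unfold absCos; fun_prop

lemma measurableSet_le_absCos (x : F) (t : ℝ) : MeasurableSet {y | t ≤ absCos x y} :=
  measurableSet_le measurable_const (measurable_absCos.comp measurable_prodMk_left)

/-- A measure that is invariant under all reflections in hyperplanes. -/
def ReflectionInvariant (μ : Measure F) : Prop :=
  ∀ v : F, MeasurePreserving (Submodule.reflection (ℝ ∙ v)ᗮ) μ μ

/-- After rescaling y to the norm of x, a single hyperplane reflection carries x to y; this is why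
invariance under reflections suffices. -/
lemma ReflectionInvariant.measure_le_absCos_eq {μ : Measure F} (hμ : ReflectionInvariant μ)
    {x y : F} (hx : x ≠ 0) (hy : y ≠ 0) (t : ℝ) :
    μ {z | t ≤ absCos x z} = μ {z | t ≤ absCos y z} := by
  have hc : ‖x‖ / ‖y‖ ≠ 0 := by positivity
  set y' := (‖x‖ / ‖y‖) • y with hy'
  have hn : ‖x‖ = ‖y'‖ := by
    have : ‖y‖ ≠ 0 := by positivity
    rw [hy', norm_smul, Real.norm_eq_abs, abs_of_nonneg (by positivity)]; field_simp
  have h1 : {z | t ≤ absCos y z} = {z | t ≤ absCos y' z} := by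
    ext z; simp [hy', absCos_smul_left _ _ hc]
  set R := Submodule.reflection (ℝ ∙ (x - y'))ᗮ
  have hR : R x = y' := Submodule.reflection_sub hn
  have h2 : R ⁻¹' {z | t ≤ absCos y' z} = {z | t ≤ absCos x z} := by
    ext z; simp only [Set.mem_preimage, Set.mem_ofPred_eq, ← hR, absCos_map]
  rw [h1, ← h2, (hμ (x - y')).measure_preimage (measurableSet_le_absCos y' t).nullMeasurableSet]

/-- Compute the mass of the symmetric relation under μ ⊗ ν in both orders. Each inner integral is
almost everywhere constant, so the two constants agree. -/
lemma ReflectionInvariant.measure_le_absCos_eq_of_prob {μ ν : Measure F} [IsProbabilityMeasure μ]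
    [IsProbabilityMeasure ν] (hμ : ReflectionInvariant μ) (hν : ReflectionInvariant ν)
    (hμ0 : μ {0} = 0) (hν0 : ν {0} = 0) {x : F} (hx : x ≠ 0) (t : ℝ) :
    μ {z | t ≤ absCos x z} = ν {z | t ≤ absCos x z} := by
  have hS : MeasurableSet {z : F × F | t ≤ absCos z.1 z.2} :=
    measurableSet_le measurable_const measurable_absCos
  have h1 : (μ.prod ν) {z : F × F | t ≤ absCos z.1 z.2} = ν {z | t ≤ absCos x z} := by
    rw [Measure.prod_apply hS]
    have : ∀ᵐ y ∂μ, ν (Prod.mk y ⁻¹' {z : F × F | t ≤ absCos z.1 z.2})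
        = ν {z | t ≤ absCos x z} := by
      filter_upwards [measure_eq_zero_iff_ae_notMem.1 hμ0] with y hy
      exact hν.measure_le_absCos_eq hy hx t
    rw [lintegral_congr_ae this]; simp
  have h2 : (μ.prod ν) {z : F × F | t ≤ absCos z.1 z.2} = μ {z | t ≤ absCos x z} := by
    rw [Measure.prod_apply_symm hS]
    have : ∀ᵐ y ∂ν, μ ((fun x => (x, y)) ⁻¹' {z : F × F | t ≤ absCos z.1 z.2})
        = μ {z | t ≤ absCos x z} := by
      filter_upwards [measure_eq_zero_iff_ae_notMem.1 hν0] with y hy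
      simp only [Set.preimage_ofPred_eq, absCos_comm _ y]
      exact hμ.measure_le_absCos_eq hy hx t
    rw [lintegral_congr_ae this]; simp
  rw [← h1, ← h2]

variable (F) in
/-- The uniform distribution on the unit ball. -/
noncomputable def ballUniform : Measure F := (volume : Measure F)[|Metric.ball 0 1]

instance : IsProbabilityMeasure (ballUniform F) :=
  cond_isProbabilityMeasure_of_finite (Metric.measure_ball_pos _ _ one_pos).ne'
    measure_ball_lt_top.ne

lemma ballUniform_apply (s : Set F) :
    ballUniform F s = (volume (Metric.ball (0 : F) 1))⁻¹ * volume (Metric.ball 0 1 ∩ s) :=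
  cond_apply Metric.isOpen_ball.measurableSet _ _

lemma reflectionInvariant_ballUniform : ReflectionInvariant (ballUniform F) := by
  intro v
  set R := Submodule.reflection (ℝ ∙ v)ᗮ
  refine ⟨R.continuous.measurable, ?_⟩
  ext s hs
  rw [Measure.map_apply R.continuous.measurable hs, ballUniform_apply,
    ballUniform_apply]
  congr 1
  have : Metric.ball (0 : F) 1 ∩ R ⁻¹' s = R ⁻¹' (Metric.ball 0 1 ∩ s) := by
    ext z; simp
  rw [this, R.measurePreserving.measure_preimage
    (Metric.isOpen_ball.measurableSet.inter hs).nullMeasurableSet]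

lemma ballUniform_submodule (S : Submodule ℝ F) (hS : S ≠ ⊤) :
    ballUniform F S = 0 := by
  rw [ballUniform_apply]
  simp [measure_mono_null Set.inter_subset_right (Measure.addHaar_submodule volume S hS)]

lemma ballUniform_zero (hF : 1 ≤ Module.finrank ℝ F) : ballUniform F {0} = 0 := by
  have := ballUniform_submodule (⊥ : Submodule ℝ F) fun h => by
    rw [← finrank_top ℝ F, ← h] at hF; simp at hF
  simpa using this

lemma ballUniform_one_le_absCos (hF : 2 ≤ Module.finrank ℝ F) (x : F) :
    ballUniform F {z | 1 ≤ absCos x z} = 0 := by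
  refine measure_mono_null (fun z hz => mem_span_of_one_le_absCos hz)
    (ballUniform_submodule (Submodule.span ℝ {x}) fun h => ?_)
  have := finrank_span_le_card (R := ℝ) ({x} : Set F)
  have h2 : Module.finrank ℝ (Submodule.span ℝ {x}) = Module.finrank ℝ F := by
    rw [h, finrank_top]
  simp only [Set.toFinset_singleton, Finset.card_singleton] at this
  omega

lemma ReflectionInvariant.measure_one_le_absCos {μ : Measure F} [IsProbabilityMeasure μ]
    (hμ : ReflectionInvariant μ) (hμ0 : μ {0} = 0) (hF : 2 ≤ Module.finrank ℝ F) {x : F}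
    (hx : x ≠ 0) : μ {z | 1 ≤ absCos x z} = 0 := by
  rw [hμ.measure_le_absCos_eq_of_prob reflectionInvariant_ballUniform hμ0
    (ballUniform_zero (by omega)) hx, ballUniform_one_le_absCos hF]

/-- Applied to the line of constant vectors, this shows that centring almost surely does not kill a
column. -/
lemma ReflectionInvariant.measure_span_singleton {μ : Measure F} [IsProbabilityMeasure μ]
    (hμ : ReflectionInvariant μ) (hμ0 : μ {0} = 0) (hF : 2 ≤ Module.finrank ℝ F) {x : F}
    (hx : x ≠ 0) : μ (Submodule.span ℝ {x}) = 0 := by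
  refine measure_mono_null (t := {0} ∪ {z | 1 ≤ absCos x z}) (fun z hz => ?_)
    (measure_union_null hμ0 (hμ.measure_one_le_absCos hμ0 hF hx))
  by_cases h : z = 0
  · exact Or.inl h
  · exact Or.inr (one_le_absCos_of_mem_span h hz)

end Sphere

/-! ### Volume of a double cone in the ball -/

lemma lintegral_comp_smul_addHaar {V : Type*} [NormedAddCommGroup V] [NormedSpace ℝ V]
    [FiniteDimensional ℝ V] [MeasurableSpace V] [BorelSpace V] (μ : Measure V)
    [μ.IsAddHaarMeasure] {f : V → ENNReal} (hf : Measurable f) {r : ℝ} (hr : 0 < r) :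
    ∫⁻ x, f (r • x) ∂μ = ENNReal.ofReal (r ^ Module.finrank ℝ V)⁻¹ * ∫⁻ x, f x ∂μ := by
  rw [← lintegral_map hf (measurable_const_smul r), Measure.map_addHaar_smul μ hr.ne',
    lintegral_smul_measure, abs_of_pos (by positivity)]
  rfl

/-- The tail integral of the (unnormalised) density `(1 + s ^ 2) ^ (-k / 2)`. -/
noncomputable def tailIntegral (k : ℕ) (a : ℝ) : ℝ := ∫ s in Set.Ioi a, (√(1 + s ^ 2) ^ k)⁻¹

lemma continuous_inv_sqrt_pow (k : ℕ) : Continuous fun s : ℝ => (√(1 + s ^ 2) ^ k)⁻¹ := by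
  refine Continuous.inv₀ (by fun_prop) fun s => ?_
  positivity

lemma integrable_inv_sqrt_pow {k : ℕ} (hk : 2 ≤ k) :
    Integrable fun s : ℝ => (√(1 + s ^ 2) ^ k)⁻¹ := by
  refine integrable_inv_one_add_sq.mono' (continuous_inv_sqrt_pow k).aestronglyMeasurable
    (ae_of_all _ fun s => ?_)
  rw [Real.norm_of_nonneg (by positivity)]
  have h1 : 1 ≤ √(1 + s ^ 2) := Real.one_le_sqrt.2 (by nlinarith [sq_nonneg s])
  calc (√(1 + s ^ 2) ^ k)⁻¹ ≤ (√(1 + s ^ 2) ^ 2)⁻¹ := by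
        gcongr
    _ = (1 + s ^ 2)⁻¹ := by rw [Real.sq_sqrt (by positivity)]

lemma tailIntegral_nonneg (k : ℕ) (a : ℝ) : 0 ≤ tailIntegral k a :=
  integral_nonneg fun s => by positivity

lemma lintegral_le_abs_inv_sqrt_pow {k : ℕ} (hk : 2 ≤ k) {a : ℝ} (ha : 0 ≤ a) :
    ∫⁻ s in {s : ℝ | a ≤ |s|}, ENNReal.ofReal (√(1 + s ^ 2) ^ k)⁻¹
      = ENNReal.ofReal (2 * tailIntegral k a) := by
  have hm : MeasurableSet {s : ℝ | a ≤ |s|} := measurableSet_le measurable_const (by fun_prop)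
  rw [← ofReal_integral_eq_lintegral_ofReal (integrable_inv_sqrt_pow hk).integrableOn
    (ae_of_all _ fun s => by positivity), ← integral_indicator hm]
  congr 1
  have h1 : ({s : ℝ | a ≤ |s|}.indicator fun s : ℝ => (√(1 + s ^ 2) ^ k)⁻¹)
      = fun s => (Set.Ici a).indicator (fun s : ℝ => (√(1 + s ^ 2) ^ k)⁻¹) |s| := by
    ext s; simp [Set.indicator_apply]
  rw [h1, integral_comp_abs (f := (Set.Ici a).indicator (fun s : ℝ => (√(1 + s ^ 2) ^ k)⁻¹)),
    ← integral_Ici_eq_integral_Ioi, setIntegral_indicator measurableSet_Ici, tailIntegral,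
    ← integral_Ici_eq_integral_Ioi]
  congr 3
  ext s; simp only [Set.mem_inter_iff, Set.mem_Ici]; constructor
  · exact fun h => h.2
  · exact fun h => ⟨ha.trans h, h⟩

section Cap

variable (V : Type*) [NormedAddCommGroup V] [InnerProductSpace ℝ V] [FiniteDimensional ℝ V]
  [MeasurableSpace V] [BorelSpace V]

/-- Substituting z.1 = ‖y‖ s turns the cone condition into a ≤ |s|, free of y, and the ball
condition into √(1 + s²) ‖y‖ < 1. Rescaling y then gives one power of √(1 + s²) for each dimension
of V and one more from the Jacobian ‖y‖. The first factor does not involve a, so it cancels in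
probabilities. -/
lemma volume_prod_cone [Nontrivial V] {a : ℝ} (ha : 0 ≤ a) :
    volume {z : ℝ × V | z.1 ^ 2 + ‖z.2‖ ^ 2 < 1 ∧ a * ‖z.2‖ ≤ |z.1|}
      = (∫⁻ y : V, ENNReal.ofReal ‖y‖ * (Metric.ball (0 : V) 1).indicator 1 y) *
        ENNReal.ofReal (2 * tailIntegral (Module.finrank ℝ V + 1) a) := by
  have hS : MeasurableSet {z : ℝ × V | z.1 ^ 2 + ‖z.2‖ ^ 2 < 1 ∧ a * ‖z.2‖ ≤ |z.1|} :=
    MeasurableSet.inter (s₁ := {z : ℝ × V | z.1 ^ 2 + ‖z.2‖ ^ 2 < 1})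
      (s₂ := {z : ℝ × V | a * ‖z.2‖ ≤ |z.1|})
      (measurableSet_lt (by fun_prop) measurable_const)
      (measurableSet_le (by fun_prop) (by fun_prop))
  set f : V → ENNReal := fun y => ENNReal.ofReal ‖y‖ * (Metric.ball (0 : V) 1).indicator 1 y
    with hf
  have hfm : Measurable f :=
    (by fun_prop : Measurable fun y : V => ENNReal.ofReal ‖y‖).mul
      (measurable_one.indicator Metric.isOpen_ball.measurableSet)
  have hA : MeasurableSet {s : ℝ | a ≤ |s|} := measurableSet_le measurable_const (by fun_prop)
  set G : V → ℝ → ENNReal := fun y s => {s : ℝ | a ≤ |s|}.indicator 1 s *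
    (ENNReal.ofReal (√(1 + s ^ 2))⁻¹ * f (√(1 + s ^ 2) • y)) with hG
  have hGm : Measurable (Function.uncurry G) := by
    refine ((measurable_one.indicator hA).comp measurable_snd).mul (Measurable.mul ?_ (hfm.comp ?_))
    · fun_prop
    · fun_prop
  have hslice : ∀ᵐ y : V, volume ((fun x : ℝ => (x, y)) ⁻¹'
      {z : ℝ × V | z.1 ^ 2 + ‖z.2‖ ^ 2 < 1 ∧ a * ‖z.2‖ ≤ |z.1|}) = ∫⁻ s, G y s := by
    have h0 : ∀ᵐ y : V, y ∉ ({0} : Set V) :=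
      measure_eq_zero_iff_ae_notMem.1 (measure_singleton 0)
    filter_upwards [h0] with y hy
    have hy' : 0 < ‖y‖ := norm_pos_iff.2 hy
    set T := (fun x : ℝ => (x, y)) ⁻¹'
      {z : ℝ × V | z.1 ^ 2 + ‖z.2‖ ^ 2 < 1 ∧ a * ‖z.2‖ ≤ |z.1|} with hT
    have hTm : MeasurableSet T := measurable_prodMk_right hS
    have h1 := Measure.addHaar_preimage_smul (volume : Measure ℝ) hy'.ne' T
    have h2 : volume T = ENNReal.ofReal ‖y‖ * volume ((‖y‖ • ·) ⁻¹' T) := by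
      rw [h1, ← mul_assoc, ← ENNReal.ofReal_mul hy'.le]
      simp [hy'.ne']
    rw [h2, ← lintegral_indicator_one (measurable_const_smul ‖y‖ hTm), ← lintegral_const_mul _
      (measurable_one.indicator (measurable_const_smul ‖y‖ hTm))]
    refine lintegral_congr fun s => ?_
    have hr : 0 < √(1 + s ^ 2) := by positivity
    have hr2 : √(1 + s ^ 2) ^ 2 = 1 + s ^ 2 := Real.sq_sqrt (by positivity)
    have hmem : s ∈ (‖y‖ • ·) ⁻¹' T ↔ a ≤ |s| ∧ √(1 + s ^ 2) • y ∈ Metric.ball (0 : V) 1 := by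
      simp only [hT, Set.mem_preimage, Set.mem_ofPred_eq, smul_eq_mul, abs_mul, abs_norm,
        mem_ball_zero_iff, norm_smul, Real.norm_eq_abs, abs_of_pos hr]
      have hsq : √(1 + s ^ 2) * ‖y‖ < 1 ↔ (1 + s ^ 2) * ‖y‖ ^ 2 < 1 := by
        rw [← sq_lt_one_iff₀ (by positivity), mul_pow, hr2]
      rw [mul_comm a, mul_le_mul_iff_right₀ hy', and_comm, hsq]
      constructor <;> rintro ⟨h1, h2⟩ <;> exact ⟨h1, by linarith⟩
    have e1 : ENNReal.ofReal ‖y‖ = ENNReal.ofReal (√(1 + s ^ 2))⁻¹ *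
        ENNReal.ofReal ‖√(1 + s ^ 2) • y‖ := by
      rw [← ENNReal.ofReal_mul (by positivity), norm_smul, Real.norm_eq_abs, abs_of_pos hr,
        inv_mul_cancel_left₀ hr.ne']
    by_cases c1 : a ≤ |s| <;> by_cases c2 : √(1 + s ^ 2) • y ∈ Metric.ball (0 : V) 1
    · rw [Set.indicator_of_mem (hmem.2 ⟨c1, c2⟩)]
      simp only [hG, hf, Set.indicator_of_mem c2]
      rw [Set.indicator_of_mem (show s ∈ {s : ℝ | a ≤ |s|} from c1), e1]
      simp
    · rw [Set.indicator_of_notMem (fun h => c2 (hmem.1 h).2)]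
      simp only [hG, hf, Set.indicator_of_notMem c2]
      simp
    · rw [Set.indicator_of_notMem (fun h => c1 (hmem.1 h).1)]
      simp only [hG]
      rw [Set.indicator_of_notMem (show s ∉ {s : ℝ | a ≤ |s|} from c1)]
      simp
    · rw [Set.indicator_of_notMem (fun h => c1 (hmem.1 h).1)]
      simp only [hG]
      rw [Set.indicator_of_notMem (show s ∉ {s : ℝ | a ≤ |s|} from c1)]
      simp
  rw [Measure.volume_eq_prod, Measure.prod_apply_symm hS, lintegral_congr_ae hslice,
    lintegral_lintegral_swap hGm.aemeasurable,
    ← lintegral_le_abs_inv_sqrt_pow (by have := Module.finrank_pos (R := ℝ) (M := V); omega) ha,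
    ← lintegral_indicator hA, ← lintegral_const_mul _ (Measurable.indicator (by fun_prop) hA)]
  refine lintegral_congr fun s => ?_
  have hr : 0 < √(1 + s ^ 2) := by positivity
  simp only [hG]
  have hm1 : Measurable fun y : V => f (√(1 + s ^ 2) • y) := hfm.comp (by fun_prop)
  rw [lintegral_const_mul _ (hm1.const_mul _), lintegral_const_mul _ hm1,
    lintegral_comp_smul_addHaar _ hfm hr, ← mul_assoc (ENNReal.ofReal _),
    ← ENNReal.ofReal_mul (by positivity), ← mul_inv, ← pow_succ']
  by_cases c : a ≤ |s|
  · rw [Set.indicator_of_mem (show s ∈ {s : ℝ | a ≤ |s|} from c),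
      Set.indicator_of_mem (show s ∈ {s : ℝ | a ≤ |s|} from c), Pi.one_apply, one_mul, mul_comm]
  · rw [Set.indicator_of_notMem (show s ∉ {s : ℝ | a ≤ |s|} from c),
      Set.indicator_of_notMem (show s ∉ {s : ℝ | a ≤ |s|} from c)]
    simp

end Cap

section CapProbability

variable {F : Type*} [NormedAddCommGroup F] [InnerProductSpace ℝ F] [FiniteDimensional ℝ F]
  [MeasurableSpace F] [BorelSpace F]

/-- A cosine at least t is a cotangent at least t / √(1 - t²). The two descriptions can differ at
the origin, which is null. -/
lemma volume_ball_inter_le_absCos_prod {V : Type*} [NormedAddCommGroup V] [InnerProductSpace ℝ V]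
    [FiniteDimensional ℝ V] [MeasurableSpace V] [BorelSpace V] [Nontrivial V] {t : ℝ}
    (ht0 : 0 ≤ t) (ht1 : t < 1) :
    volume (Metric.ball (0 : WithLp 2 (ℝ × V)) 1 ∩
        {z | t ≤ absCos (WithLp.toLp 2 ((1 : ℝ), (0 : V))) z})
      = (∫⁻ y : V, ENNReal.ofReal ‖y‖ * (Metric.ball (0 : V) 1).indicator 1 y) *
        ENNReal.ofReal (2 * tailIntegral (Module.finrank ℝ V + 1) (t / √(1 - t ^ 2))) := by
  have h1t : 0 < 1 - t ^ 2 := by nlinarith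
  rw [← volume_prod_cone V (by positivity), ← (WithLp.volume_preserving_toLp ℝ V).measure_preimage
    (Metric.isOpen_ball.measurableSet.inter (measurableSet_le_absCos _ t)).nullMeasurableSet]
  refine measure_congr ?_
  have h0 : ∀ᵐ z : ℝ × V, z ∉ ({0} : Set (ℝ × V)) :=
    measure_eq_zero_iff_ae_notMem.1 (by
      rw [Measure.volume_eq_prod, show ({0} : Set (ℝ × V)) = {0} ×ˢ {0} by
        ext; simp [Prod.ext_iff], Measure.prod_prod]
      simp)
  filter_upwards [h0] with z hz
  obtain ⟨g, y⟩ := z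
  have hn : ‖WithLp.toLp 2 (g, y)‖ ^ 2 = g ^ 2 + ‖y‖ ^ 2 := by
    rw [WithLp.prod_norm_sq_eq_of_L2]; simp
  have hn1 : ‖WithLp.toLp 2 ((1 : ℝ), (0 : V))‖ = 1 := by
    rw [← sq_eq_sq₀ (norm_nonneg _) zero_le_one, WithLp.prod_norm_sq_eq_of_L2]; simp
  have hpos : 0 < ‖WithLp.toLp 2 (g, y)‖ := by
    rw [norm_pos_iff]
    intro h
    apply hz
    simpa using h
  refine propext ?_
  change (WithLp.toLp 2 (g, y) ∈ Metric.ball (0 : WithLp 2 (ℝ × V)) 1 ∧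
    t ≤ absCos (WithLp.toLp 2 ((1 : ℝ), (0 : V))) (WithLp.toLp 2 (g, y))) ↔
    (g ^ 2 + ‖y‖ ^ 2 < 1 ∧ t / √(1 - t ^ 2) * ‖y‖ ≤ |g|)
  have hin : inner ℝ (WithLp.toLp 2 ((1 : ℝ), (0 : V))) (WithLp.toLp 2 (g, y)) = g := by
    simp [WithLp.prod_inner_apply]
  refine and_congr ?_ ?_
  · rw [mem_ball_zero_iff, ← sq_lt_one_iff₀ (norm_nonneg _), hn]
  · have e1 : t * ‖WithLp.toLp 2 (g, y)‖ ≤ |g| ↔ t ^ 2 * (g ^ 2 + ‖y‖ ^ 2) ≤ g ^ 2 := by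
      rw [← sq_le_sq₀ (by positivity) (by positivity), mul_pow, hn, sq_abs]
    have e2 : t * ‖y‖ ≤ |g| * √(1 - t ^ 2) ↔ t ^ 2 * ‖y‖ ^ 2 ≤ g ^ 2 * (1 - t ^ 2) := by
      rw [← sq_le_sq₀ (by positivity) (by positivity), mul_pow, mul_pow, sq_abs,
        Real.sq_sqrt h1t.le]
    rw [absCos, hin, hn1, one_mul, le_div_iff₀ hpos, div_mul_eq_mul_div,
      div_le_iff₀ (Real.sqrt_pos.2 h1t), e1, e2]
    constructor <;> intro h <;> linarith

/-- The probability of a double cone under the uniform distribution on the ball. -/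
lemma ballUniform_le_absCos {k : ℕ} (hk : 2 ≤ k) (hF : Module.finrank ℝ F = k) {x : F}
    (hx : x ≠ 0) {t : ℝ} (ht0 : 0 ≤ t) (ht1 : t < 1) :
    ballUniform F {z | t ≤ absCos x z}
      = ENNReal.ofReal (tailIntegral k (t / √(1 - t ^ 2)) / tailIntegral k 0) := by
  let V := EuclideanSpace ℝ (Fin (k - 1))
  have hV : Module.finrank ℝ V = k - 1 := by simp [V]
  have : Nontrivial V := (Module.finrank_pos_iff (R := ℝ)).1 (by rw [hV]; omega)
  have hM : Module.finrank ℝ F = Module.finrank ℝ (WithLp 2 (ℝ × V)) := by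
    rw [(WithLp.linearEquiv 2 ℝ (ℝ × V)).finrank_eq, Module.finrank_prod, hV, hF]
    simp; omega
  let U : F ≃ₗᵢ[ℝ] WithLp 2 (ℝ × V) :=
    (stdOrthonormalBasis ℝ F).equiv (stdOrthonormalBasis ℝ _) (finCongr hM)
  set e : WithLp 2 (ℝ × V) := WithLp.toLp 2 ((1 : ℝ), (0 : V)) with he
  have he0 : e ≠ 0 := fun h => by
    have := congrArg WithLp.fst h
    simp [he] at this
  have hx' : U.symm e ≠ 0 := by simpa using he0
  have hpre : ∀ s : ℝ, volume (Metric.ball (0 : F) 1 ∩ {z | s ≤ absCos (U.symm e) z})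
      = volume (Metric.ball (0 : WithLp 2 (ℝ × V)) 1 ∩ {z | s ≤ absCos e z}) := by
    intro s
    rw [← U.measurePreserving.measure_preimage
      (Metric.isOpen_ball.measurableSet.inter (measurableSet_le_absCos e s)).nullMeasurableSet]
    congr 1
    ext z
    have := absCos_map U (U.symm e) z
    rw [U.apply_symm_apply] at this
    simp [this]
  -- Level 0 gives the whole ball, so the normalising constant is the same formula at t = 0. Its
  -- volume being neither 0 nor ∞ also shows that the common factor can be cancelled.
  have h0 := volume_ball_inter_le_absCos_prod (V := V) le_rfl zero_lt_one
  have ht := volume_ball_inter_le_absCos_prod (V := V) ht0 ht1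
  rw [← he, ← hpre, hV, Nat.sub_add_cancel (by omega)] at h0 ht
  rw [show {z : F | (0 : ℝ) ≤ absCos (U.symm e) z} = Set.univ from
    Set.eq_univ_of_forall fun z => absCos_nonneg _ _, Set.inter_univ] at h0
  rw [reflectionInvariant_ballUniform.measure_le_absCos_eq hx hx', ballUniform_apply, ht]
  set K := ∫⁻ y : V, ENNReal.ofReal ‖y‖ * (Metric.ball (0 : V) 1).indicator 1 y
  have hv0 : volume (Metric.ball (0 : F) 1) ≠ 0 := (Metric.measure_ball_pos _ _ one_pos).ne'
  have hvt : volume (Metric.ball (0 : F) 1) ≠ ⊤ := measure_ball_lt_top.ne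
  rw [h0] at hv0 hvt ⊢
  rw [zero_div] at hv0 hvt ⊢
  have hA : ENNReal.ofReal (2 * tailIntegral k 0) ≠ 0 := right_ne_zero_of_mul hv0
  have hK0 : K ≠ 0 := left_ne_zero_of_mul hv0
  have hKt : K ≠ ⊤ := fun h => hvt (by rw [h, ENNReal.top_mul hA])
  have hApos : 0 < tailIntegral k 0 := by
    have := ENNReal.ofReal_pos.1 (pos_iff_ne_zero.2 hA); linarith
  rw [mul_comm, ← div_eq_mul_inv, ENNReal.mul_div_mul_left _ _ hK0 hKt,
    ← ENNReal.ofReal_div_of_pos (by positivity), mul_div_mul_left _ _ two_ne_zero]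

/-- The law of the cosine between a vector with a reflection-invariant distribution and a fixed
direction. -/
lemma ReflectionInvariant.measure_le_absCos {μ : Measure F} [IsProbabilityMeasure μ]
    (hμ : ReflectionInvariant μ) (hμ0 : μ {0} = 0) {k : ℕ} (hk : 2 ≤ k)
    (hF : Module.finrank ℝ F = k) {x : F} (hx : x ≠ 0) {t : ℝ} (ht0 : 0 ≤ t) (ht1 : t < 1) :
    μ {z | t ≤ absCos x z}
      = ENNReal.ofReal (tailIntegral k (t / √(1 - t ^ 2)) / tailIntegral k 0) := by
  rw [hμ.measure_le_absCos_eq_of_prob reflectionInvariant_ballUniform hμ0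
    (ballUniform_zero (by omega)) hx, ballUniform_le_absCos hk hF hx ht0 ht1]

end CapProbability

/-! ### Centring as an orthogonal projection -/

section Reflection

variable {F : Type*} [NormedAddCommGroup F] [InnerProductSpace ℝ F]

lemma reflection_orthogonal_singleton_apply (v x : F) :
    Submodule.reflection (ℝ ∙ v)ᗮ x = x - (2 * (inner ℝ v x / ‖v‖ ^ 2)) • v := by
  rw [Submodule.reflection_orthogonal_apply, Submodule.reflection_singleton_apply, mul_smul]
  simp [two_smul]

variable [FiniteDimensional ℝ F] [MeasurableSpace F] [BorelSpace F]

/-- For v in S, the reflection of the ambient space along v commutes with the projection onto S and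
induces the reflection of S along v. -/
lemma ReflectionInvariant.map_orthogonalProjectionOnto {μ : Measure F} (hμ : ReflectionInvariant μ)
    (S : Submodule ℝ F) : ReflectionInvariant (μ.map S.orthogonalProjectionOnto) := by
  intro v
  set R := Submodule.reflection (ℝ ∙ v)ᗮ
  set R' := Submodule.reflection (ℝ ∙ (v : F))ᗮ
  have hT : Measurable S.orthogonalProjectionOnto := S.orthogonalProjectionOnto.continuous.measurable
  have hR : Measurable R := R.continuous.measurable
  have hcomm : R ∘ S.orthogonalProjectionOnto = S.orthogonalProjectionOnto ∘ R' := by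
    ext x
    simp only [R, R', Function.comp_apply, reflection_orthogonal_singleton_apply, map_sub, map_smul,
      Submodule.orthogonalProjectionOnto_mem_subspace_eq_self]
    have : inner ℝ v (S.orthogonalProjectionOnto x) = inner ℝ (v : F) x :=
      Submodule.inner_orthogonalProjectionOnto_eq_of_mem_left v x
    rw [this, Submodule.coe_norm]
  refine ⟨hR, ?_⟩
  rw [Measure.map_map hR hT, hcomm, ← Measure.map_map hT R'.continuous.measurable,
    (hμ (v : F)).map_eq]

end Reflection

/-- A spherical distribution on `Fin n → ℝ`, viewed on Euclidean space, is invariant under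
reflections. -/
lemma IsSpherical.reflectionInvariant {Ω : Type*} [MeasurableSpace Ω] {P : Measure Ω} {n : ℕ}
    {Y : Ω → Fin n → ℝ} (hY : IsSpherical P Y) (hm : Measurable Y) :
    ReflectionInvariant
      (P.map fun ω => (WithLp.toLp 2 (Y ω) : EuclideanSpace ℝ (Fin n))) := by
  intro v
  set R := Submodule.reflection (ℝ ∙ v)ᗮ
  set b := EuclideanSpace.basisFun (Fin n) ℝ
  have hO := hY _ (b.toMatrix_orthonormalBasis_mem_orthogonal (b.map R))
  have htoLp : Measurable (WithLp.toLp 2 : (Fin n → ℝ) → EuclideanSpace ℝ (Fin n)) := by fun_prop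
  have hR : Measurable R := R.continuous.measurable
  refine ⟨hR, ?_⟩
  have hYm : Measurable fun ω => (WithLp.toLp 2 (Y ω) : EuclideanSpace ℝ (Fin n)) := htoLp.comp hm
  rw [Measure.map_map hR hYm]
  have h1 : (R ∘ fun ω => WithLp.toLp 2 (Y ω)) = WithLp.toLp 2 ∘
      fun ω => (b.toBasis.toMatrix (b.map R)).mulVec (Y ω) := by
    ext ω i
    have : WithLp.toLp 2 (Y ω) = ∑ j, Y ω j • b j := by
      rw [← b.sum_repr (WithLp.toLp 2 (Y ω))]; simp [b]
    simp only [Function.comp_apply]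
    rw [this, map_sum]
    simp [Matrix.mulVec, dotProduct, Module.Basis.toMatrix_apply, b, mul_comm]
  have h2 : (fun ω => WithLp.toLp 2 (Y ω)) = WithLp.toLp 2 ∘ Y := rfl
  rw [h1, h2, ← Measure.map_map htoLp hm, ← hO.map_eq]
  refine (AEMeasurable.map_map_of_aemeasurable htoLp.aemeasurable hO.aemeasurable_fst).symm

/-- The hyperplane of centered vectors. -/
noncomputable abbrev centeredSubmodule (n : ℕ) : Submodule ℝ (EuclideanSpace ℝ (Fin n)) :=
  (ℝ ∙ (WithLp.toLp 2 fun _ => 1 : EuclideanSpace ℝ (Fin n)))ᗮ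

/-- The centered vector `x - x̄`, as an element of the hyperplane of centered vectors. -/
noncomputable def centered {n : ℕ} (x : Fin n → ℝ) : centeredSubmodule n :=
  (centeredSubmodule n).orthogonalProjectionOnto (WithLp.toLp 2 x)

lemma measurable_centered {n : ℕ} : Measurable (centered : (Fin n → ℝ) → centeredSubmodule n) := by
  unfold centered; fun_prop

lemma coe_centered_apply {n : ℕ} (x : Fin n → ℝ) (k : Fin n) :
    (centered x : EuclideanSpace ℝ (Fin n)) k = x k - coordMean x := by
  rw [centered, Submodule.orthogonalProjectionOnto_orthogonal]
  simp [Submodule.starProjection_singleton, coordMean, PiLp.inner_apply, EuclideanSpace.norm_sq_eq]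

lemma abs_pearson {n : ℕ} (x y : Fin n → ℝ) :
    |pearson x y| = absCos (centered x) (centered y) := by
  have hn : ∀ z : Fin n → ℝ, √(∑ k, (z k - coordMean z) ^ 2) = ‖centered z‖ := by
    intro z
    rw [Submodule.coe_norm, EuclideanSpace.norm_eq]
    simp [coe_centered_apply]
  rw [pearson, abs_div, abs_of_nonneg (Real.sqrt_nonneg _), Real.sqrt_mul (by positivity), hn, hn,
    absCos]
  congr 2
  rw [Submodule.coe_inner, PiLp.inner_apply]
  simp [coe_centered_apply, mul_comm]

lemma finrank_centeredSubmodule {n : ℕ} (hn : 1 ≤ n) :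
    Module.finrank ℝ (centeredSubmodule n) = n - 1 := by
  have : Fact (Module.finrank ℝ (EuclideanSpace ℝ (Fin n)) = (n - 1) + 1) := ⟨by simp; omega⟩
  refine Submodule.finrank_orthogonal_span_singleton fun h => ?_
  have := congrArg (fun v : EuclideanSpace ℝ (Fin n) => v ⟨0, hn⟩) h
  simp at this

section Columns

variable {Ω : Type*} [MeasurableSpace Ω] {P : Measure Ω} {n : ℕ}
  {Y : Ω → Fin n → ℝ}

lemma IsSpherical.reflectionInvariant_centered (hY : IsSpherical P Y) (hm : Measurable Y) :
    ReflectionInvariant (P.map fun ω => centered (Y ω)) := by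
  have := (hY.reflectionInvariant hm).map_orthogonalProjectionOnto (centeredSubmodule n)
  rwa [Measure.map_map (by fun_prop) (by fun_prop)] at this

/-- A centred vector vanishes exactly when the original one lies on the line of constants, which is
null in dimension at least 2. -/
lemma IsSpherical.measure_centered_eq_zero [IsProbabilityMeasure P]
    (hY : IsSpherical P Y) (hm : Measurable Y)
    (h0 : P {ω | Y ω = 0} = 0) (hn : 2 ≤ n) : (P.map fun ω => centered (Y ω)) {0} = 0 := by
  have hm' : Measurable fun ω => WithLp.toLp 2 (Y ω) := by fun_prop
  have hP : IsProbabilityMeasure (P.map fun ω => WithLp.toLp 2 (Y ω)) :=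
    Measure.isProbabilityMeasure_map hm'.aemeasurable
  have hz : (P.map fun ω => WithLp.toLp 2 (Y ω)) {0} = 0 := by
    rw [Measure.map_apply hm' (measurableSet_singleton 0)]
    convert h0 using 2
    ext ω; simp
  have h1 : (WithLp.toLp 2 fun _ => 1 : EuclideanSpace ℝ (Fin n)) ≠ 0 := fun h => by
    have := congrArg (fun v : EuclideanSpace ℝ (Fin n) => v ⟨0, by omega⟩) h
    simp at this
  have := (hY.reflectionInvariant hm).measure_span_singleton hz (by simpa using hn) h1
  rw [Measure.map_apply hm' (Submodule.closed_of_finiteDimensional _).measurableSet] at this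
  have hmc : Measurable fun ω => centered (Y ω) := measurable_centered.comp hm
  rw [Measure.map_apply hmc (measurableSet_singleton 0)]
  refine measure_mono_null (fun ω hω => ?_) this
  have h2 : centered (Y ω) = 0 := hω
  rw [centered, Submodule.orthogonalProjectionOnto_eq_zero_iff, Submodule.orthogonal_orthogonal]
    at h2
  exact h2

end Columns

/-! ### Pairwise relations between independent variables -/

section Pairs

variable {Ω α : Type*} [MeasurableSpace Ω] [MeasurableSpace α] {P : Measure Ω}
  [IsProbabilityMeasure P] {p : ℕ} {Y : Fin p → Ω → α} {μ : Measure α} [IsProbabilityMeasure μ]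
  {B : Set (α × α)} {q : ℝ}

lemma measureReal_pair_mem (hm : ∀ i, Measurable (Y i)) (hind : iIndepFun Y P)
    (hμ : ∀ i, P.map (Y i) = μ) (hB : MeasurableSet B) (hq0 : 0 ≤ q)
    (hq : ∀ᵐ x ∂μ, μ (Prod.mk x ⁻¹' B) = ENNReal.ofReal q) {i j : Fin p} (hij : i ≠ j) :
    P.real {ω | (Y i ω, Y j ω) ∈ B} = q := by
  have h1 := (indepFun_iff_map_prod_eq_prod_map_map (hm i).aemeasurable (hm j).aemeasurable).1
    (hind.indepFun hij)
  have h2 : P {ω | (Y i ω, Y j ω) ∈ B} = ENNReal.ofReal q := by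
    change P ((fun ω => (Y i ω, Y j ω)) ⁻¹' B) = _
    rw [← Measure.map_apply ((hm i).prodMk (hm j)) hB, h1, hμ, hμ, Measure.prod_apply hB,
      lintegral_congr_ae hq]
    simp
  rw [measureReal_def, h2, ENNReal.toReal_ofReal hq0]

/-- Given the shared variable, the two events are independent with the same constant probability q,
so sharing an index creates no correlation. -/
lemma measureReal_pair_mem_inter (hm : ∀ i, Measurable (Y i)) (hind : iIndepFun Y P)
    (hμ : ∀ i, P.map (Y i) = μ) (hB : MeasurableSet B) (hq0 : 0 ≤ q)
    (hq : ∀ᵐ x ∂μ, μ (Prod.mk x ⁻¹' B) = ENNReal.ofReal q) {i j k : Fin p} (hij : i ≠ j)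
    (hik : i ≠ k) (hjk : j ≠ k) :
    P.real ({ω | (Y i ω, Y j ω) ∈ B} ∩ {ω | (Y i ω, Y k ω) ∈ B}) = q * q := by
  have h1 := (indepFun_iff_map_prod_eq_prod_map_map (hm j).aemeasurable (hm k).aemeasurable).1
    (hind.indepFun hjk)
  have h2 := (indepFun_iff_map_prod_eq_prod_map_map ((hm j).prodMk (hm k)).aemeasurable
    (hm i).aemeasurable).1 (hind.indepFun_prodMk hm j k i hij.symm hik.symm)
  rw [h1, hμ, hμ, hμ] at h2
  set C : Set ((α × α) × α) := {z | (z.2, z.1.1) ∈ B ∧ (z.2, z.1.2) ∈ B}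
  have hC : MeasurableSet C :=
    MeasurableSet.inter (s₁ := {z : (α × α) × α | (z.2, z.1.1) ∈ B})
      (s₂ := {z : (α × α) × α | (z.2, z.1.2) ∈ B})
      ((by fun_prop : Measurable fun z : (α × α) × α => (z.2, z.1.1)) hB)
      ((by fun_prop : Measurable fun z : (α × α) × α => (z.2, z.1.2)) hB)
  have h3 : P ({ω | (Y i ω, Y j ω) ∈ B} ∩ {ω | (Y i ω, Y k ω) ∈ B})
      = ENNReal.ofReal q * ENNReal.ofReal q := by
    change P ((fun ω => ((Y j ω, Y k ω), Y i ω)) ⁻¹' C) = _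
    rw [← Measure.map_apply (((hm j).prodMk (hm k)).prodMk (hm i)) hC, h2,
      Measure.prod_apply_symm hC]
    have : ∀ᵐ x ∂μ, (μ.prod μ) ((fun z => (z, x)) ⁻¹' C)
        = ENNReal.ofReal q * ENNReal.ofReal q := by
      filter_upwards [hq] with x hx
      rw [← hx, ← Measure.prod_prod]
      rfl
    rw [lintegral_congr_ae this]
    simp
  rw [measureReal_def, h3, ENNReal.toReal_mul, ENNReal.toReal_ofReal hq0]

lemma card_lt_pairs (p : ℕ) : Fintype.card {a : Fin p × Fin p // a.1 < a.2} = p.choose 2 := by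
  rw [Fintype.card_subtype]
  have h1 : (Finset.univ.filter fun a : Fin p × Fin p => a.1 < a.2).card
      = ∑ j : Fin p, (j : ℕ) := by
    rw [Finset.card_filter, ← Finset.univ_product_univ, Finset.sum_product_right]
    refine Finset.sum_congr rfl fun j _ => ?_
    rw [← Finset.card_filter, Finset.filter_gt_eq_Iio, Fin.card_Iio]
  rw [h1, Fin.sum_univ_eq_sum_range (fun i => i), Finset.sum_range_id, Nat.choose_two_right]

/-- The pairs that share an index with the pair `a`. -/
def neighborPairs {p : ℕ} (a : {a : Fin p × Fin p // a.1 < a.2}) :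
    Finset {a : Fin p × Fin p // a.1 < a.2} :=
  Finset.univ.filter fun b =>
    (b.1.1 = a.1.1 ∨ b.1.1 = a.1.2) ∨ (b.1.2 = a.1.1 ∨ b.1.2 = a.1.2)

/-- There are four ways for an index to coincide, and each leaves at most p choices for the other
index. -/
lemma card_neighborPairs_le {p : ℕ} (a : {a : Fin p × Fin p // a.1 < a.2}) :
    (neighborPairs a).card ≤ 4 * p := by
  have h1 : ∀ i : Fin p, (Finset.univ.filter
      fun b : {a : Fin p × Fin p // a.1 < a.2} => b.1.1 = i).card ≤ p := by
    intro i
    refine (Finset.card_le_card_of_injOn (t := Finset.univ) (fun b => b.1.2) (by simp) ?_).trans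
      (by simp)
    rintro ⟨⟨b1, b2⟩, hb⟩ h ⟨⟨c1, c2⟩, hc⟩ h' heq
    simp_all
  have h2 : ∀ i : Fin p, (Finset.univ.filter
      fun b : {a : Fin p × Fin p // a.1 < a.2} => b.1.2 = i).card ≤ p := by
    intro i
    refine (Finset.card_le_card_of_injOn (t := Finset.univ) (fun b => b.1.1) (by simp) ?_).trans
      (by simp)
    rintro ⟨⟨b1, b2⟩, hb⟩ h ⟨⟨c1, c2⟩, hc⟩ h' heq
    simp_all
  unfold neighborPairs
  rw [Finset.filter_or, Finset.filter_or, Finset.filter_or]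
  refine (Finset.card_union_le _ _).trans ?_
  have h3 := (Finset.card_union_le _ _).trans (add_le_add (h1 a.1.1) (h1 a.1.2))
  have h4 := (Finset.card_union_le _ _).trans (add_le_add (h2 a.1.1) (h2 a.1.2))
  omega

open Classical in
lemma indepFun_indicator_card (hm : ∀ i, Measurable (Y i)) (hind : iIndepFun Y P)
    (hB : MeasurableSet B) (a : {a : Fin p × Fin p // a.1 < a.2}) :
    IndepFun ({ω | (Y a.1.1 ω, Y a.1.2 ω) ∈ B}.indicator fun _ => (1 : ℝ))
      (fun ω => (Finset.univ.filter fun b : {a : Fin p × Fin p // a.1 < a.2} =>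
        b ∉ neighborPairs a ∧ ω ∈ {ω | (Y b.1.1 ω, Y b.1.2 ω) ∈ B}).card) P := by
  obtain ⟨ω₀⟩ := nonempty_of_isProbabilityMeasure P
  set S : Finset (Fin p) := {a.1.1, a.1.2} with hS
  set T : Finset (Fin p) := Finset.univ \ S with hT
  have h0 := hind.indepFun_finset S T Finset.disjoint_sdiff hm
  let φ : (S → α) → ℝ := fun z =>
    {z : S → α | (z ⟨a.1.1, by simp [hS]⟩, z ⟨a.1.2, by simp [hS]⟩) ∈ B}.indicator (fun _ => 1) z
  -- The values at `ω₀` are mere padding: a pair that is not a neighbour has both indices in T.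
  let e : (T → α) → Fin p → α := fun z i => if h : i ∈ T then z ⟨i, h⟩ else Y i ω₀
  let ψ : (T → α) → ℕ := fun z => (Finset.univ.filter
    fun b : {a : Fin p × Fin p // a.1 < a.2} =>
      b ∉ neighborPairs a ∧ (e z b.1.1, e z b.1.2) ∈ B).card
  have hφ : Measurable φ := by
    refine measurable_const.indicator (?_ : MeasurableSet _)
    exact (by fun_prop : Measurable fun z : S → α =>
      (z ⟨a.1.1, _⟩, z ⟨a.1.2, _⟩)) hB
  have he : ∀ i, Measurable fun z => e z i := by
    intro i
    by_cases h : i ∈ T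
    · simp only [e, h, dif_pos]; fun_prop
    · simp [e, h]
  have hψ : Measurable ψ := by
    simp only [ψ, Finset.card_filter]
    refine Finset.measurable_sum _ fun b _ => ?_
    by_cases hb : b ∉ neighborPairs a
    · simp only [hb, not_false_eq_true, true_and]
      exact Measurable.ite (((he _).prodMk (he _)) hB) measurable_const measurable_const
    · simp [hb]
  have h1 := h0.comp hφ hψ
  convert h1 using 1
  · funext ω
    simp [φ, Set.indicator_apply]
  funext ω
  refine congrArg Finset.card (Finset.ext fun b => ?_)
  simp only [Finset.mem_filter, Finset.mem_univ, true_and]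
  refine and_congr_right fun hb => ?_
  have hb' : b.1.1 ∈ T ∧ b.1.2 ∈ T := by
    simp only [neighborPairs, Finset.mem_filter, Finset.mem_univ, true_and] at hb
    simp only [hT, hS, Finset.mem_sdiff, Finset.mem_univ, true_and, Finset.mem_insert,
      Finset.mem_singleton]
    tauto
  simp [e, hb'.1, hb'.2]

/-- Poisson approximation for the probability that no pair of i.i.d. variables satisfies a
symmetric relation, when the relation has constant conditional probability `q`. -/
theorem abs_measureReal_no_pair_sub_exp_le (hm : ∀ i, Measurable (Y i)) (hind : iIndepFun Y P)
    (hμ : ∀ i, P.map (Y i) = μ) (hB : MeasurableSet B) (hsymm : ∀ x y, (x, y) ∈ B → (y, x) ∈ B)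
    (hq0 : 0 ≤ q) (hq : ∀ᵐ x ∂μ, μ (Prod.mk x ⁻¹' B) = ENNReal.ofReal q) :
    |P.real {ω | ∀ i j, i < j → (Y i ω, Y j ω) ∉ B} - Real.exp (-((p.choose 2 : ℕ) * q))| ≤
      8 * p ^ 3 * q ^ 2 := by
  classical
  let A : {a : Fin p × Fin p // a.1 < a.2} → Set Ω := fun a => {ω | (Y a.1.1 ω, Y a.1.2 ω) ∈ B}
  have hA : ∀ a, MeasurableSet (A a) := fun a => ((hm a.1.1).prodMk (hm a.1.2)) hB
  have hPA : ∀ a, P.real (A a) = q := fun a =>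
    measureReal_pair_mem hm hind hμ hB hq0 hq a.2.ne
  have hsym : ∀ i j, {ω | (Y i ω, Y j ω) ∈ B} = {ω | (Y j ω, Y i ω) ∈ B} := fun i j =>
    Set.ext fun ω => ⟨hsymm _ _, hsymm _ _⟩
  have hPAA : ∀ a, ∀ b ∈ neighborPairs a, b ≠ a → P.real (A a ∩ A b) ≤ q * q := by
    rintro ⟨⟨i, j⟩, hij⟩ ⟨⟨k, l⟩, hkl⟩ hb hne
    simp only [neighborPairs, ne_eq, Subtype.mk.injEq, Prod.mk.injEq,
      Finset.mem_filter, Finset.mem_univ, true_and] at hb hne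
    simp only at hij hkl
    -- Symmetry of B moves the shared index to the first slot; the remaining indices differ because
    -- the pairs are ordered and distinct.
    obtain (rfl | rfl) | (rfl | rfl) := hb
    · exact (measureReal_pair_mem_inter hm hind hμ hB hq0 hq hij.ne hkl.ne
        (fun h => hne ⟨rfl, h.symm⟩)).le
    · simp only [A]
      rw [hsym i]
      exact (measureReal_pair_mem_inter hm hind hμ hB hq0 hq hij.ne' hkl.ne
        (hij.trans hkl).ne).le
    · simp only [A]
      rw [hsym k]
      exact (measureReal_pair_mem_inter hm hind hμ hB hq0 hq hij.ne hkl.ne'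
        (hkl.trans hij).ne').le
    · simp only [A]
      rw [hsym i, hsym k]
      exact (measureReal_pair_mem_inter hm hind hμ hB hq0 hq hij.ne' hkl.ne'
        (fun h => hne ⟨h.symm, rfl⟩)).le
  have key := abs_measureReal_none_sub_exp_le P A hA neighborPairs
    (fun a => by simp [neighborPairs]) (fun a => by
      convert indepFun_indicator_card hm hind hB a)
  have hset : {ω | ∀ a, ω ∉ A a} = {ω | ∀ i j, i < j → (Y i ω, Y j ω) ∉ B} := by
    ext ω
    simp [A]
  have hcard : (Fintype.card {a : Fin p × Fin p // a.1 < a.2} : ℝ) ≤ p ^ 2 := by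
    have h1 : Fintype.card {a : Fin p × Fin p // a.1 < a.2} ≤ p ^ 2 := by
      refine (Fintype.card_subtype_le _).trans ?_
      simp [sq]
    exact_mod_cast h1
  have hN : ∀ a : {a : Fin p × Fin p // a.1 < a.2}, ((neighborPairs a).card : ℝ) ≤ 4 * p :=
    fun a => by exact_mod_cast card_neighborPairs_le a
  rw [hset] at key
  simp only [hPA, Finset.sum_const, nsmul_eq_mul, Finset.card_univ, card_lt_pairs] at key
  refine key.trans ?_
  have hqq : 0 ≤ q * q := mul_nonneg hq0 hq0
  -- At most p² pairs with at most 4p neighbours each. Both Chen–Stein sums obey this bound, whence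
  -- the constant 8.
  have b1 : ∑ a : {a : Fin p × Fin p // a.1 < a.2}, ((neighborPairs a).card : ℝ) * (q * q)
      ≤ p ^ 2 * (4 * p * (q * q)) := by
    refine (Finset.sum_le_card_nsmul _ _ (4 * p * (q * q)) fun a _ =>
      mul_le_mul_of_nonneg_right (hN a) hqq).trans ?_
    rw [nsmul_eq_mul, Finset.card_univ]
    exact mul_le_mul_of_nonneg_right hcard (by positivity)
  refine (add_le_add b1 (le_trans (Finset.sum_le_sum fun a _ => ?_) b1)).trans
    (le_of_eq (by ring))
  refine (Finset.sum_le_card_nsmul _ _ (q * q) fun b hb => hPAA a b (Finset.mem_of_mem_erase hb)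
    (Finset.ne_of_mem_erase hb)).trans ?_
  rw [nsmul_eq_mul]
  refine mul_le_mul_of_nonneg_right ?_ hqq
  exact_mod_cast Finset.card_le_card (Finset.erase_subset _ _)

/-- Union bound for the probability that some pair satisfies the relation. -/
lemma measureReal_exists_pair_le (hm : ∀ i, Measurable (Y i)) (hind : iIndepFun Y P)
    (hμ : ∀ i, P.map (Y i) = μ) (hB : MeasurableSet B) (hq0 : 0 ≤ q)
    (hq : ∀ᵐ x ∂μ, μ (Prod.mk x ⁻¹' B) = ENNReal.ofReal q) :
    P.real {ω | ∃ i j, i < j ∧ (Y i ω, Y j ω) ∈ B} ≤ p ^ 2 * q := by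
  have h1 : {ω | ∃ i j, i < j ∧ (Y i ω, Y j ω) ∈ B} =
      ⋃ a : {a : Fin p × Fin p // a.1 < a.2}, {ω | (Y a.1.1 ω, Y a.1.2 ω) ∈ B} := by
    ext ω; simp
  rw [h1]
  refine (measureReal_iUnion_fintype_le _).trans ?_
  rw [Finset.sum_congr rfl fun a _ => measureReal_pair_mem hm hind hμ hB hq0 hq a.2.ne]
  rw [Finset.sum_const, nsmul_eq_mul, Finset.card_univ]
  refine mul_le_mul_of_nonneg_right ?_ hq0
  have h1 : Fintype.card {a : Fin p × Fin p // a.1 < a.2} ≤ p ^ 2 := by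
    refine (Fintype.card_subtype_le _).trans ?_
    simp [sq]
  exact_mod_cast h1

end Pairs

/-! ### Distribution of the coherence at finite n -/

lemma coherence_nonneg {n p : ℕ} (x : Fin p → Fin n → ℝ) : 0 ≤ coherence x :=
  Real.iSup_nonneg fun _ => abs_nonneg _

/-- The supremum runs over a finite nonempty family, hence is attained; without a pair it would be 0
by convention. -/
lemma le_coherence_iff {n p : ℕ} (hp : 2 ≤ p) (x : Fin p → Fin n → ℝ) (t : ℝ) :
    t ≤ coherence x ↔ ∃ i j, i < j ∧ t ≤ absCos (centered (x i)) (centered (x j)) := by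
  have hne : Nonempty {q : Fin p × Fin p // q.1 < q.2} :=
    ⟨⟨(⟨0, by omega⟩, ⟨1, by omega⟩), by simp⟩⟩
  simp only [← abs_pearson]
  constructor
  · intro h
    obtain ⟨q, hq⟩ := exists_eq_ciSup_of_finite
      (f := fun q : {q : Fin p × Fin p // q.1 < q.2} => |pearson (x q.1.1) (x q.1.2)|)
    exact ⟨q.1.1, q.1.2, q.2, by rw [hq]; exact h⟩
  · rintro ⟨i, j, hij, h⟩
    exact h.trans (le_ciSup (f := fun q : {q : Fin p × Fin p // q.1 < q.2} =>
      |pearson (x q.1.1) (x q.1.2)|) (Set.finite_range _).bddAbove ⟨(i, j), hij⟩)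

lemma measurable_coherence {Ω : Type*} [MeasurableSpace Ω] {n p : ℕ} {X : Fin p → Ω → Fin n → ℝ}
    (hX : ∀ j, Measurable (X j)) : Measurable fun ω => coherence fun j => X j ω := by
  unfold coherence
  refine Measurable.iSup fun q => ?_
  simp only [abs_pearson]
  exact measurable_absCos.comp
    ((measurable_centered.comp (hX _)).prodMk (measurable_centered.comp (hX _)))

/-- The probability that the correlation coefficient of two independent spherical vectors in `ℝⁿ`
is at least `t` in absolute value. -/
noncomputable def corrTail (n : ℕ) (t : ℝ) : ℝ :=
  tailIntegral (n - 1) (t / √(1 - t ^ 2)) / tailIntegral (n - 1) 0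

lemma corrTail_nonneg (n : ℕ) (t : ℝ) : 0 ≤ corrTail n t :=
  div_nonneg (tailIntegral_nonneg _ _) (tailIntegral_nonneg _ _)

namespace IIDSphericalColumns

variable {Ω : Type*} [MeasurableSpace Ω] {P : Measure Ω} {n p : ℕ}
  {X : Fin p → Ω → Fin n → ℝ}

lemma map_centered_eq (hX : IIDSphericalColumns P X) (i j : Fin p) :
    P.map (fun ω => centered (X i ω)) = P.map fun ω => centered (X j ω) :=
  ((hX.identDistrib i j).comp measurable_centered).map_eq

lemma iIndepFun_centered (hX : IIDSphericalColumns P X) :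
    iIndepFun (fun j ω => centered (X j ω)) P :=
  hX.indep.comp (fun _ => centered) fun _ => measurable_centered

variable [IsProbabilityMeasure P]

/-- Only x = 0 is exceptional, and it is null. The bound on n makes the hyperplane of dimension n -
1 at least a plane. -/
lemma ae_measure_le_absCos (hX : IIDSphericalColumns P X) (hn : 3 ≤ n) (i : Fin p) {t : ℝ}
    (ht0 : 0 ≤ t) (ht1 : t < 1) :
    ∀ᵐ x ∂(P.map fun ω => centered (X i ω)), (P.map fun ω => centered (X i ω))
      (Prod.mk x ⁻¹' {z | t ≤ absCos z.1 z.2}) = ENNReal.ofReal (corrTail n t) := by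
  have hm : Measurable fun ω => centered (X i ω) := measurable_centered.comp (hX.measurable i)
  have : IsProbabilityMeasure (P.map fun ω => centered (X i ω)) :=
    Measure.isProbabilityMeasure_map hm.aemeasurable
  have h0 := (hX.spherical i).measure_centered_eq_zero (hX.measurable i) (hX.no_atom i) (by omega)
  filter_upwards [measure_eq_zero_iff_ae_notMem.1 h0] with x hx
  exact ((hX.spherical i).reflectionInvariant_centered (hX.measurable i)).measure_le_absCos h0
    (by omega) (finrank_centeredSubmodule (by omega)) hx ht0 ht1

/-- The endpoint needs its own statement: at t = 1 the quotient in `corrTail` degenerates to a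
division by zero. -/
lemma ae_measure_one_le_absCos (hX : IIDSphericalColumns P X) (hn : 3 ≤ n) (i : Fin p) :
    ∀ᵐ x ∂(P.map fun ω => centered (X i ω)), (P.map fun ω => centered (X i ω))
      (Prod.mk x ⁻¹' {z | 1 ≤ absCos z.1 z.2}) = ENNReal.ofReal 0 := by
  have hm : Measurable fun ω => centered (X i ω) := measurable_centered.comp (hX.measurable i)
  have : IsProbabilityMeasure (P.map fun ω => centered (X i ω)) :=
    Measure.isProbabilityMeasure_map hm.aemeasurable
  have h0 := (hX.spherical i).measure_centered_eq_zero (hX.measurable i) (hX.no_atom i) (by omega)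
  filter_upwards [measure_eq_zero_iff_ae_notMem.1 h0] with x hx
  rw [ENNReal.ofReal_zero]
  refine ((hX.spherical i).reflectionInvariant_centered (hX.measurable i)).measure_one_le_absCos h0
    ?_ hx
  rw [finrank_centeredSubmodule (by omega)]
  omega

lemma abs_measureReal_coherence_lt_sub_exp_le (hX : IIDSphericalColumns P X) (hn : 3 ≤ n)
    (hp : 2 ≤ p) {t : ℝ} (ht0 : 0 ≤ t) (ht1 : t < 1) :
    |P.real {ω | coherence (fun j => X j ω) < t}
        - Real.exp (-((p.choose 2 : ℕ) * corrTail n t))| ≤ 8 * p ^ 3 * corrTail n t ^ 2 := by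
  have hm : ∀ j, Measurable fun ω => centered (X j ω) :=
    fun j => measurable_centered.comp (hX.measurable j)
  let i₀ : Fin p := ⟨0, by omega⟩
  have : IsProbabilityMeasure (P.map fun ω => centered (X i₀ ω)) :=
    Measure.isProbabilityMeasure_map (hm _).aemeasurable
  have key := abs_measureReal_no_pair_sub_exp_le hm hX.iIndepFun_centered
    (fun i => hX.map_centered_eq i i₀)
    (measurableSet_le measurable_const measurable_absCos)
    (fun x y h => by simpa [absCos_comm] using h) (corrTail_nonneg n t)
    (hX.ae_measure_le_absCos hn i₀ ht0 ht1)
  have hset : {ω | coherence (fun j => X j ω) < t} = {ω | ∀ i j, i < j →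
      (centered (X i ω), centered (X j ω)) ∉ {z : centeredSubmodule n × centeredSubmodule n |
        t ≤ absCos z.1 z.2}} := by
    ext ω
    simp only [Set.mem_ofPred_eq]
    rw [← not_le, le_coherence_iff hp]
    push Not
    simp
  rw [hset]
  exact key

lemma measureReal_le_coherence_le (hX : IIDSphericalColumns P X) (hn : 3 ≤ n)
    (hp : 2 ≤ p) {t : ℝ} (ht0 : 0 ≤ t) (ht1 : t < 1) :
    P.real {ω | t ≤ coherence (fun j => X j ω)} ≤ p ^ 2 * corrTail n t := by
  have hm : ∀ j, Measurable fun ω => centered (X j ω) :=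
    fun j => measurable_centered.comp (hX.measurable j)
  let i₀ : Fin p := ⟨0, by omega⟩
  have : IsProbabilityMeasure (P.map fun ω => centered (X i₀ ω)) :=
    Measure.isProbabilityMeasure_map (hm _).aemeasurable
  have key := measureReal_exists_pair_le hm hX.iIndepFun_centered
    (fun i => hX.map_centered_eq i i₀)
    (measurableSet_le measurable_const measurable_absCos) (corrTail_nonneg n t)
    (hX.ae_measure_le_absCos hn i₀ ht0 ht1)
  simp only [le_coherence_iff hp]
  exact key

lemma measureReal_one_le_coherence (hX : IIDSphericalColumns P X) (hn : 3 ≤ n) (hp : 2 ≤ p) :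
    P.real {ω | 1 ≤ coherence (fun j => X j ω)} = 0 := by
  have hm : ∀ j, Measurable fun ω => centered (X j ω) :=
    fun j => measurable_centered.comp (hX.measurable j)
  let i₀ : Fin p := ⟨0, by omega⟩
  have : IsProbabilityMeasure (P.map fun ω => centered (X i₀ ω)) :=
    Measure.isProbabilityMeasure_map (hm _).aemeasurable
  have key := measureReal_exists_pair_le hm hX.iIndepFun_centered
    (fun i => hX.map_centered_eq i i₀)
    (measurableSet_le measurable_const measurable_absCos) le_rfl
    (hX.ae_measure_one_le_absCos hn i₀)
  simp only [le_coherence_iff hp]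
  rw [mul_zero] at key
  exact le_antisymm key measureReal_nonneg

end IIDSphericalColumns

/-! ### Asymptotics of the correlation tail -/

/-- The leading term of `tailIntegral (j + 2) x`. -/
noncomputable def tailMain (j : ℕ) (x : ℝ) : ℝ := (√(1 + x ^ 2) ^ j)⁻¹ / (j * x)

lemma tailMain_pos {j : ℕ} (hj : 1 ≤ j) {x : ℝ} (hx : 0 < x) : 0 < tailMain j x := by
  unfold tailMain
  have : (0 : ℝ) < j := by exact_mod_cast hj
  positivity

/-- The derivative is the integrand of `tailIntegral (j + 2)` times a factor close to 1 when j and j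
s² are large. -/
lemma hasDerivAt_neg_tailMain {j : ℕ} (hj : 1 ≤ j) {s : ℝ} (hs : 0 < s) :
    HasDerivAt (fun s => -tailMain j s)
      ((√(1 + s ^ 2) ^ (j + 2))⁻¹ * (1 + (1 + (s ^ 2)⁻¹) / j)) s := by
  have hj' : (j : ℝ) ≠ 0 := by exact_mod_cast (by omega : j ≠ 0)
  have hpos : 0 < 1 + s ^ 2 := by positivity
  have hr : 0 < √(1 + s ^ 2) := by positivity
  have hr2 : √(1 + s ^ 2) ^ 2 = 1 + s ^ 2 := Real.sq_sqrt hpos.le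
  have h1 : HasDerivAt (fun s : ℝ => √(1 + s ^ 2)) (s / √(1 + s ^ 2)) s := by
    have := ((hasDerivAt_pow 2 s).const_add 1).sqrt hpos.ne'
    refine this.congr_deriv ?_
    field_simp
    simp
  have h2 := ((h1.pow j).inv (pow_ne_zero j hr.ne')).div ((hasDerivAt_id s).const_mul (j : ℝ))
    (by simp [hj', hs.ne']) |>.neg
  refine h2.congr_deriv ?_
  obtain ⟨i, rfl⟩ : ∃ i, j = i + 1 := ⟨j - 1, by omega⟩
  have hs2 : s ^ 2 = √(1 + s ^ 2) ^ 2 - 1 := by rw [hr2]; ring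
  simp only [id, Nat.add_sub_cancel, Pi.pow_apply, Pi.inv_apply]
  set r := √(1 + s ^ 2)
  field_simp
  push_cast at hj' ⊢
  rw [hs2]
  ring

lemma tendsto_tailMain_atTop {j : ℕ} (hj : 1 ≤ j) :
    Tendsto (fun s => -tailMain j s) atTop (𝓝 0) := by
  have hj' : (1 : ℝ) ≤ j := by exact_mod_cast hj
  rw [← neg_zero]
  refine Tendsto.neg ?_
  refine squeeze_zero' (g := fun s : ℝ => s⁻¹) ?_ ?_ tendsto_inv_atTop_zero
  · filter_upwards [eventually_gt_atTop 0] with s hs using (tailMain_pos hj hs).le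
  · filter_upwards [eventually_gt_atTop 0] with s hs
    have h1 : 1 ≤ √(1 + s ^ 2) := Real.one_le_sqrt.2 (by nlinarith [sq_nonneg s])
    rw [tailMain, div_eq_mul_inv]
    calc (√(1 + s ^ 2) ^ j)⁻¹ * (j * s)⁻¹ ≤ 1 * (1 * s)⁻¹ := by
          gcongr
          exact inv_le_one_of_one_le₀ (one_le_pow₀ h1)
      _ = s⁻¹ := by simp

/-- A Mills-ratio estimate: `tailMain j x` is the integral of its derivative, whose extra factor is
at least 1 and decreasing, hence at most its value at x. -/
lemma tailIntegral_bounds {j : ℕ} (hj : 1 ≤ j) {x : ℝ} (hx : 0 < x) :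
    tailIntegral (j + 2) x ≤ tailMain j x ∧
      tailMain j x ≤ (1 + (1 + (x ^ 2)⁻¹) / j) * tailIntegral (j + 2) x := by
  have hd : ∀ s ∈ Set.Ioi x, HasDerivAt (fun s => -tailMain j s)
      ((√(1 + s ^ 2) ^ (j + 2))⁻¹ * (1 + (1 + (s ^ 2)⁻¹) / j)) s :=
    fun s hs => hasDerivAt_neg_tailMain hj (hx.trans hs)
  have hc : ContinuousWithinAt (fun s => -tailMain j s) (Set.Ici x) x :=
    (hasDerivAt_neg_tailMain hj hx).continuousAt.continuousWithinAt
  have hpos : ∀ s ∈ Set.Ioi x, 0 ≤ (√(1 + s ^ 2) ^ (j + 2))⁻¹ * (1 + (1 + (s ^ 2)⁻¹) / j) :=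
    fun s _ => by positivity
  have hint := integrableOn_Ioi_deriv_of_nonneg hc hd hpos (tendsto_tailMain_atTop hj)
  have heq := integral_Ioi_of_hasDerivAt_of_nonneg hc hd hpos (tendsto_tailMain_atTop hj)
  rw [zero_sub, neg_neg] at heq
  have hint' : IntegrableOn (fun s : ℝ => (√(1 + s ^ 2) ^ (j + 2))⁻¹) (Set.Ioi x) :=
    (integrable_inv_sqrt_pow (by omega)).integrableOn
  rw [← heq, tailIntegral, ← integral_const_mul]
  constructor
  · refine setIntegral_mono_on hint' hint measurableSet_Ioi fun s _ => ?_
    refine le_mul_of_one_le_right (by positivity) ?_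
    have : 0 ≤ (1 + (s ^ 2)⁻¹) / (j : ℝ) := by positivity
    linarith
  · refine setIntegral_mono_on hint (hint'.const_mul _) measurableSet_Ioi fun s hs => ?_
    rw [mul_comm]
    have hxs : x < s := hs
    gcongr

/-- With u = √k s the integrand tends to exp(-u²/2). Bernoulli's inequality with exponent k/2 ≥ 1
supplies the dominating function 2 / (1 + u²). -/
lemma tendsto_sqrt_mul_tailIntegral_zero :
    Tendsto (fun k : ℕ => √k * tailIntegral k 0) atTop (𝓝 (√(Real.pi / (1 / 2)) / 2)) := by
  have hrew : ∀ k : ℕ, 1 ≤ k → √k * tailIntegral k 0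
      = ∫ u in Set.Ioi (0 : ℝ), (√(1 + u ^ 2 / k) ^ k)⁻¹ := by
    intro k hk
    have hk' : (0 : ℝ) < k := by exact_mod_cast hk
    have h1 := integral_comp_mul_left_Ioi (fun u : ℝ => (√(1 + u ^ 2 / k) ^ k)⁻¹) 0
      (Real.sqrt_pos.2 hk')
    rw [mul_zero, smul_eq_mul] at h1
    have h2 : tailIntegral k 0
        = ∫ s in Set.Ioi (0 : ℝ), (√(1 + (√k * s) ^ 2 / k) ^ k)⁻¹ := by
      unfold tailIntegral
      congr 1; ext s
      rw [mul_pow, Real.sq_sqrt hk'.le, mul_div_cancel_left₀ _ hk'.ne']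
    rw [h2, h1, mul_inv_cancel_left₀ (Real.sqrt_pos.2 hk').ne']
  rw [← integral_gaussian_Ioi]
  refine Tendsto.congr' (f₁ := fun k : ℕ => ∫ u in Set.Ioi (0 : ℝ), (√(1 + u ^ 2 / k) ^ k)⁻¹) ?_ ?_
  · filter_upwards [eventually_ge_atTop 1] with k hk using (hrew k hk).symm
  refine tendsto_integral_filter_of_dominated_convergence (fun u : ℝ => 2 * (1 + u ^ 2)⁻¹) ?_ ?_ ?_ ?_
  · refine Eventually.of_forall fun k => Continuous.aestronglyMeasurable ?_
    refine Continuous.inv₀ (by fun_prop) fun s => ?_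
    positivity
  · filter_upwards [eventually_ge_atTop 2] with k hk
    refine ae_of_all _ fun u => ?_
    have hk' : (2 : ℝ) ≤ k := by exact_mod_cast hk
    rw [Real.norm_of_nonneg (by positivity)]
    have h1 : 1 + u ^ 2 / 2 ≤ √(1 + u ^ 2 / k) ^ k := by
      have hs : 0 ≤ u ^ 2 / (k : ℝ) := by positivity
      have := one_add_mul_self_le_rpow_one_add (s := u ^ 2 / k) (by linarith) (p := (k : ℝ) / 2)
        (by linarith)
      rw [Real.sqrt_eq_rpow, ← Real.rpow_natCast ((1 + u ^ 2 / (k : ℝ)) ^ (1 / 2 : ℝ)), ← Real.rpow_mul (by positivity)]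
      convert this using 2
      · field_simp
      · ring
    rw [← div_eq_mul_inv, inv_le_comm₀ (by positivity) (by positivity), inv_div]
    refine le_trans ?_ h1
    linarith
  · exact (integrable_inv_one_add_sq.const_mul 2).integrableOn
  · refine ae_of_all _ fun u => ?_
    have h1 := (Real.tendsto_one_add_div_pow_exp (u ^ 2)).sqrt.inv₀ (by positivity)
    have h2 : (√(Real.exp (u ^ 2)))⁻¹ = Real.exp (-(1 / 2) * u ^ 2) := by
      rw [← Real.exp_half, ← Real.exp_neg]; congr 1; ring
    rw [h2] at h1
    refine h1.congr fun k => ?_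
    congr 1
    rw [Real.sqrt_eq_iff_mul_self_eq (by positivity) (by positivity), ← mul_pow,
      Real.mul_self_sqrt (by positivity)]

/-- The parameter s = -log(1 - t²) is the scale on which the limit theorem is stated. -/
lemma sqrt_div_sqrt_one_sub {s : ℝ} (hs : 0 < s) :
    √(1 - Real.exp (-s)) / √(1 - √(1 - Real.exp (-s)) ^ 2) = √(Real.exp s - 1) := by
  have h1 : Real.exp (-s) ≤ 1 := Real.exp_le_one_iff.2 (by linarith)
  rw [Real.sq_sqrt (by linarith), sub_sub_cancel, ← Real.sqrt_div (by linarith)]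
  congr 1
  rw [sub_div, div_self (Real.exp_pos _).ne', Real.exp_neg, one_div, inv_inv]

lemma corrTail_eq {n : ℕ} (hn : 4 ≤ n) {s : ℝ} (hs : 0 < s) :
    corrTail n √(1 - Real.exp (-s))
      = tailIntegral (n - 3 + 2) √(Real.exp s - 1) / tailIntegral (n - 1) 0 := by
  rw [corrTail, sqrt_div_sqrt_one_sub hs, show n - 3 + 2 = n - 1 by omega]

lemma tailMain_sqrt_exp_sub_one (j : ℕ) {s : ℝ} (hs : 0 < s) :
    tailMain j √(Real.exp s - 1) = Real.exp (-(j * s / 2)) / (j * √(Real.exp s - 1)) := by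
  have h1 : 1 ≤ Real.exp s := Real.one_le_exp hs.le
  rw [tailMain, Real.sq_sqrt (by linarith), add_sub_cancel, ← Real.exp_half, ← Real.exp_nat_mul,
    ← Real.exp_neg]
  congr 3; ring

lemma tendsto_sqrt_pred_mul_tailIntegral_zero :
    Tendsto (fun n : ℕ => √((n : ℝ) - 1) * tailIntegral (n - 1) 0) atTop
      (𝓝 (√(Real.pi / (1 / 2)) / 2)) := by
  refine (tendsto_sqrt_mul_tailIntegral_zero.comp (tendsto_sub_atTop_nat 1)).congr' ?_
  filter_upwards [eventually_ge_atTop 1] with n hn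
  simp [Nat.cast_sub hn]

/-- If `p = exp (o(n))`, then `p ^ 2` times the tail probability at a fixed level vanishes. -/
lemma tendsto_sq_mul_corrTail_zero {p : ℕ → ℕ} (hp : ∀ n, 1 ≤ n → 2 ≤ p n)
    (hlog : Tendsto (fun n : ℕ => Real.log (p n) / n) atTop (𝓝 0)) {t : ℝ} (ht0 : 0 < t)
    (ht1 : t < 1) : Tendsto (fun n => (p n : ℝ) ^ 2 * corrTail n t) atTop (𝓝 0) := by
  have h1t : 0 < 1 - t ^ 2 := by nlinarith
  set s := -Real.log (1 - t ^ 2) with hs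
  have hs0 : 0 < s := by
    rw [hs, neg_pos]; exact Real.log_neg h1t (by nlinarith)
  have ht : t = √(1 - Real.exp (-s)) := by
    rw [hs, neg_neg, Real.exp_log h1t, sub_sub_cancel, Real.sqrt_sq ht0.le]
  set x := √(Real.exp s - 1) with hx
  have hx0 : 0 < x := Real.sqrt_pos.2 (by linarith [Real.add_one_lt_exp hs0.ne'])
  -- The exponent is 2 log p - (n - 3) s / 2, arranged so that the bracket tends to the negative
  -- number -s/2.
  have hexp : Tendsto (fun n : ℕ => (n : ℝ) * (2 * (Real.log (p n) / n) - s / 2) + 3 * s / 2)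
      atTop atBot := by
    refine tendsto_atBot_add_const_right _ _ ?_
    refine Tendsto.atTop_mul_neg (C := 2 * 0 - s / 2) (by linarith) tendsto_natCast_atTop_atTop ?_
    exact (hlog.const_mul 2).sub_const _
  have hA := tendsto_sqrt_pred_mul_tailIntegral_zero
  have hc : 0 < √(Real.pi / (1 / 2)) / 2 := by positivity
  have hlim := ((Real.tendsto_exp_atBot.comp hexp).mul (hA.inv₀ hc.ne')).mul_const x⁻¹
  rw [zero_mul, zero_mul] at hlim
  refine squeeze_zero' (Eventually.of_forall fun n => mul_nonneg (sq_nonneg _)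
    (corrTail_nonneg n t)) ?_ hlim
  filter_upwards [eventually_ge_atTop 5, hA.eventually_const_lt hc] with n hn hAn
  have hn' : (5 : ℝ) ≤ n := by exact_mod_cast hn
  have hp0 : (0 : ℝ) < p n := by exact_mod_cast (by linarith [hp n (by omega)] : 0 < p n)
  have hr : 0 < √((n : ℝ) - 1) := Real.sqrt_pos.2 (by linarith)
  have hAp : 0 < tailIntegral (n - 1) 0 := pos_of_mul_pos_right hAn hr.le
  have hcast : ((n - 3 : ℕ) : ℝ) = n - 3 := by rw [Nat.cast_sub (by omega)]; norm_num
  -- Equivalent to (n - 2)(n - 5) ≥ 0, hence the threshold 5.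
  have hr2 : √((n : ℝ) - 1) ≤ n - 3 := Real.sqrt_le_iff.2 ⟨by linarith, by nlinarith⟩
  rw [ht, corrTail_eq (by omega) hs0]
  have hb := (tailIntegral_bounds (j := n - 3) (by omega) hx0).1
  rw [tailMain_sqrt_exp_sub_one _ hs0, hcast, ← hx] at hb
  have hexp2 : Real.exp ((n : ℝ) * (2 * (Real.log (p n) / n) - s / 2) + 3 * s / 2)
      = (p n : ℝ) ^ 2 * Real.exp (-((n - 3) * s / 2)) := by
    rw [← Real.exp_log (pow_pos hp0 2), ← Real.exp_add, Real.log_pow]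
    congr 1
    push_cast
    field_simp
    ring
  simp only [Function.comp_apply]
  rw [hexp2]
  calc (p n : ℝ) ^ 2 * (tailIntegral (n - 3 + 2) x / tailIntegral (n - 1) 0)
      ≤ (p n : ℝ) ^ 2 * (Real.exp (-((n - 3) * s / 2)) / (√((n : ℝ) - 1) * x)
          / tailIntegral (n - 1) 0) := by
        gcongr
        refine hb.trans ?_
        gcongr
    _ = _ := by field_simp

/-- Sharp asymptotics of the tail of the correlation coefficient. -/
lemma tendsto_corrTail {s : ℕ → ℝ} (hpos : ∀ᶠ n in atTop, 0 < s n)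
    (h0 : Tendsto s atTop (𝓝 0)) (hinf : Tendsto (fun n : ℕ => n * s n) atTop atTop) :
    Tendsto (fun n : ℕ => corrTail n √(1 - Real.exp (-s n)) *
      (√(n * s n) * Real.exp (n * s n / 2))) atTop (𝓝 (√(Real.pi / (1 / 2)) / 2)⁻¹) := by
  have hA := tendsto_sqrt_pred_mul_tailIntegral_zero
  have hc : 0 < √(Real.pi / (1 / 2)) / 2 := by positivity
  have hn3 : Tendsto (fun n : ℕ => (n : ℝ) / (n - 3)) atTop (𝓝 1) := by
    simpa [sub_eq_add_neg] using tendsto_natCast_div_add_atTop (-3 : ℝ)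
  have hn1 : Tendsto (fun n : ℕ => (n : ℝ) / (n - 1)) atTop (𝓝 1) := by
    simpa [sub_eq_add_neg] using tendsto_natCast_div_add_atTop (-1 : ℝ)
  -- The expression factors as (tail / main term) · e^(3s/2) · √(s / (e^s - 1)) · √(n(n - 1)) / (n -
  -- 3) · (√(n - 1) `tailIntegral (n - 1) 0`)⁻¹. The first four factors tend to 1; this is the
  -- fourth.
  have hratio : Tendsto (fun n : ℕ => √((n : ℝ) / (n - 3) * (n / (n - 3) / (n / (n - 1)))))
      atTop (𝓝 1) := by
    simpa using (hn3.mul (hn3.div hn1 one_ne_zero)).sqrt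
  have hslope : Tendsto (fun n => √((Real.exp (s n) - 1) / s n)⁻¹) atTop (𝓝 1) := by
    have h1 := (hasDerivAt_iff_tendsto_slope.1 (Real.hasDerivAt_exp 0)).comp
      (tendsto_nhdsWithin_iff.2 ⟨h0, hpos.mono fun n hn => hn.ne'⟩)
    simp only [Real.exp_zero] at h1
    have h2 := (h1.inv₀ one_ne_zero).sqrt
    simpa [Function.comp_def, slope_def_field] using h2
  have hexp : Tendsto (fun n => Real.exp (3 * s n / 2)) atTop (𝓝 1) := by
    have := ((h0.const_mul 3).div_const 2).rexp
    simpa using this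
  have hcorr : Tendsto (fun n : ℕ => tailIntegral (n - 3 + 2) √(Real.exp (s n) - 1) /
      tailMain (n - 3) √(Real.exp (s n) - 1)) atTop (𝓝 1) := by
    -- Since e^s - 1 ≥ s, the relative error is at most of order 1/n + 1/(ns); here ns → ∞ is
    -- essential.
    have hup : Tendsto (fun n : ℕ => 1 + ((n : ℝ) / (n - 3) * (n : ℝ)⁻¹ +
        n / (n - 3) * (n * s n)⁻¹)) atTop (𝓝 1) := by
      simpa using ((hn3.mul (tendsto_inv_atTop_nhds_zero_nat (𝕜 := ℝ))).add
        (hn3.mul hinf.inv_tendsto_atTop)).const_add 1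
    have hlow := hup.inv₀ one_ne_zero
    rw [inv_one] at hlow
    refine tendsto_of_tendsto_of_tendsto_of_le_of_le' hlow tendsto_const_nhds ?_ ?_
    · filter_upwards [hpos, eventually_ge_atTop 4] with n hsn hn
      have hn' : (4 : ℝ) ≤ n := by exact_mod_cast hn
      have hge : s n ≤ Real.exp (s n) - 1 := by linarith [Real.add_one_le_exp (s n)]
      have hx0 : 0 < √(Real.exp (s n) - 1) := Real.sqrt_pos.2 (by linarith)
      have hB := tailMain_pos (j := n - 3) (by omega) hx0
      have hb := (tailIntegral_bounds (j := n - 3) (by omega) hx0).2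
      have hcast : ((n - 3 : ℕ) : ℝ) = n - 3 := by rw [Nat.cast_sub (by omega)]; norm_num
      rw [Real.sq_sqrt (by linarith), hcast] at hb
      have hn30 : (0 : ℝ) < n - 3 := by linarith
      rw [le_div_iff₀ hB, inv_mul_le_iff₀ (by positivity)]
      refine hb.trans (mul_le_mul_of_nonneg_right ?_ (tailIntegral_nonneg _ _))
      have h3 : (Real.exp (s n) - 1)⁻¹ ≤ (s n)⁻¹ := inv_anti₀ hsn hge
      calc 1 + (1 + (Real.exp (s n) - 1)⁻¹) / ((n : ℝ) - 3)
          ≤ 1 + (1 + (s n)⁻¹) / ((n : ℝ) - 3) := by gcongr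
        _ = _ := by field_simp
    · filter_upwards [hpos, eventually_ge_atTop 4] with n hsn hn
      have hx0 : 0 < √(Real.exp (s n) - 1) :=
        Real.sqrt_pos.2 (by linarith [Real.add_one_lt_exp hsn.ne'])
      exact div_le_one_of_le₀ (tailIntegral_bounds (j := n - 3) (by omega) hx0).1
        (tailMain_pos (by omega) hx0).le
  have hall := (((hcorr.mul hexp).mul hslope).mul hratio).mul (hA.inv₀ hc.ne')
  rw [one_mul, one_mul, one_mul, one_mul] at hall
  refine hall.congr' ?_
  filter_upwards [hpos, eventually_ge_atTop 4, hA.eventually_const_lt hc] with n hsn hn hAn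
  have hn' : (4 : ℝ) ≤ n := by exact_mod_cast hn
  have hn10 : (0 : ℝ) < n - 1 := by linarith
  have hn30 : (0 : ℝ) < n - 3 := by linarith
  have hr : 0 < √((n : ℝ) - 1) := Real.sqrt_pos.2 hn10
  have hAp : 0 < tailIntegral (n - 1) 0 := pos_of_mul_pos_right hAn hr.le
  have he0 : 0 < Real.exp (s n) - 1 := by linarith [Real.add_one_lt_exp hsn.ne']
  have hx0 : 0 < √(Real.exp (s n) - 1) := Real.sqrt_pos.2 he0
  have hcast : ((n - 3 : ℕ) : ℝ) = n - 3 := by rw [Nat.cast_sub (by omega)]; norm_num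
  have hsq : (n : ℝ) / (n - 3) * (n / (n - 3) / (n / (n - 1))) = n * (n - 1) / (n - 3) ^ 2 := by
    field_simp
  have hexp3 : Real.exp (3 * s n / 2)
      = Real.exp (n * s n / 2) * Real.exp (-(((n : ℝ) - 3) * s n / 2)) := by
    rw [← Real.exp_add]; congr 1; ring
  rw [corrTail_eq hn hsn, tailMain_sqrt_exp_sub_one _ hsn, hcast, hexp3, hsq,
    inv_div, Real.sqrt_div hsn.le, Real.sqrt_div (by positivity), Real.sqrt_sq hn30.le,
    Real.sqrt_mul (by positivity), Real.sqrt_mul (by positivity)]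
  have hE : Real.exp (-(((n : ℝ) - 3) * s n / 2)) ≠ 0 := (Real.exp_pos _).ne'
  generalize Real.exp (-(((n : ℝ) - 3) * s n / 2)) = E at hE ⊢
  field_simp

/-! ### From distribution functions to weak convergence -/

/-- Convergence of the distribution functions to a continuous one implies convergence in
distribution. -/
lemma tendstoInDistribution_of_tendsto_cdf {Ω : ℕ → Type*} [∀ n, MeasurableSpace (Ω n)]
    {P : ∀ n, Measure (Ω n)} [∀ n, IsProbabilityMeasure (P n)] {Z : ∀ n, Ω n → ℝ}
    (hZ : ∀ n, AEMeasurable (Z n) (P n)) {ν : Measure ℝ} [IsProbabilityMeasure ν]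
    (h : ∀ y, Tendsto (fun n => (P n).real {ω | Z n ω ≤ y}) atTop (𝓝 (cdf ν y))) :
    TendstoInDistribution Z atTop (id : ℝ → ℝ) P ν := by
  refine ⟨hZ, aemeasurable_id, ?_⟩
  -- Half-open intervals form a π-system containing small neighbourhoods of every point, so
  -- convergence of their masses suffices.
  refine IsPiSystem.tendsto_probabilityMeasure_of_tendsto_of_mem
    (isPiSystem_Ioc (id : ℝ → ℝ) id) ?_ ?_ ?_
  · rintro _ ⟨a, b, -, rfl⟩
    exact measurableSet_Ioc
  · intro u hu x hx
    obtain ⟨ε, hε, hb⟩ := Metric.isOpen_iff.1 hu x hx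
    refine ⟨Set.Ioc (x - ε / 2) (x + ε / 2), ⟨x - ε / 2, x + ε / 2, by simp; linarith, rfl⟩,
      Ioc_mem_nhds (by linarith) (by linarith), fun z hz => hb ?_⟩
    rw [Metric.mem_ball, Real.dist_eq, abs_lt]
    constructor <;> linarith [hz.1, hz.2]
  · rintro _ ⟨a, b, hab, rfl⟩
    have hIoc : ∀ (m : Measure ℝ) [IsProbabilityMeasure m],
        m.real (Set.Ioc a b) = m.real (Set.Iic b) - m.real (Set.Iic a) := by
      intro m _
      rw [← measureReal_sdiff (Set.Iic_subset_Iic.2 (show a ≤ b from le_of_lt hab)) measurableSet_Iic, Set.Iic_sdiff_Iic]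
    have hmap : ∀ n c, ((P n).map (Z n)).real (Set.Iic c) = (P n).real {ω | Z n ω ≤ c} :=
      fun n c => map_measureReal_apply_of_aemeasurable (hZ n) measurableSet_Iic
    rw [← NNReal.tendsto_coe]
    have hlim : Tendsto (fun n => ((P n).map (Z n)).real (Set.Ioc a b)) atTop
        (𝓝 (ν.real (Set.Ioc a b))) := by
      have hP : ∀ n, IsProbabilityMeasure ((P n).map (Z n)) :=
        fun n => Measure.isProbabilityMeasure_map (hZ n)
      simp only [hIoc, hmap]
      rw [← cdf_eq_real, ← cdf_eq_real]
      exact (h b).sub (h a)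
    convert hlim using 2
    · rfl
    · change (ν.map id).real (Set.Ioc a b) = _
      rw [Measure.map_id]

/-- The distribution function `y ↦ 1 - exp (-K exp (y / 2))` comes from a probability measure. -/
lemma exists_cdf_eq_one_sub_exp {K : ℝ} (hK : 0 < K) :
    ∃ ν : ProbabilityMeasure ℝ,
      ∀ y : ℝ, cdf (ν : Measure ℝ) y = 1 - Real.exp (-K * Real.exp (y / 2)) := by
  let F : StieltjesFunction ℝ :=
    { toFun := fun y => 1 - Real.exp (-K * Real.exp (y / 2))
      mono' := fun a b hab => by
        refine sub_le_sub_left (Real.exp_le_exp.2 ?_) 1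
        have : Real.exp (a / 2) ≤ Real.exp (b / 2) := Real.exp_le_exp.2 (by linarith)
        nlinarith
      right_continuous' := fun x => by
        refine Continuous.continuousWithinAt ?_
        fun_prop }
  have hdiv : Tendsto (fun y : ℝ => y / 2) atTop atTop := tendsto_id.atTop_div_const two_pos
  have hdiv' : Tendsto (fun y : ℝ => y / 2) atBot atBot := tendsto_id.atBot_div_const two_pos
  have h0 : Tendsto F atBot (𝓝 0) := by
    have := ((((Real.tendsto_exp_atBot.comp hdiv').const_mul (-K)).rexp).const_sub 1)
    change Tendsto (fun y => 1 - Real.exp (-K * Real.exp (y / 2))) _ _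
    simpa using this
  have h1 : Tendsto F atTop (𝓝 1) := by
    have := (Real.tendsto_exp_atBot.comp ((Real.tendsto_exp_atTop.comp hdiv).const_mul_atTop_of_neg
      (neg_lt_zero.2 hK))).const_sub 1
    change Tendsto (fun y => 1 - Real.exp (-K * Real.exp (y / 2))) _ _
    simpa using this
  have hprob : IsProbabilityMeasure F.measure :=
    ⟨by rw [F.measure_univ h0 h1, sub_zero, ENNReal.ofReal_one]⟩
  refine ⟨⟨F.measure, hprob⟩, fun y => ?_⟩
  change cdf F.measure y = _
  rw [cdf_measure_stieltjesFunction F h0 h1]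

/-! ### The critical level and the limit theorem -/

/-- The expected number of pairs with correlation at least the critical level converges. -/
lemma tendsto_sq_mul_corrTail_critical {p : ℕ → ℕ}
    (hlog : Tendsto (fun n : ℕ => Real.log (p n) / n) atTop (𝓝 0)) (hp : Tendsto p atTop atTop)
    (y : ℝ) {s : ℕ → ℝ}
    (hs : ∀ n, s n = (4 * Real.log (p n) - Real.log (Real.log (p n)) - y) / n) :
    (∀ᶠ n in atTop, 0 < s n) ∧
    Tendsto (fun n => (p n : ℝ) ^ 2 * corrTail n √(1 - Real.exp (-s n))) atTop
      (𝓝 (2 * (1 / √(8 * Real.pi) * Real.exp (y / 2)))) := by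
  have hl : Tendsto (fun n => Real.log (p n)) atTop atTop :=
    Real.tendsto_log_atTop.comp (tendsto_natCast_atTop_atTop.comp hp)
  have hl0 : ∀ᶠ n in atTop, 0 < Real.log (p n) := hl.eventually_gt_atTop 0
  -- This is ns / log p, so √(ns) is asymptotic to 2 √(log p).
  have hb : Tendsto (fun n => 4 - Real.log (Real.log (p n)) / Real.log (p n) - y / Real.log (p n))
      atTop (𝓝 4) := by
    have h1 : Tendsto (fun n => Real.log (Real.log (p n)) / Real.log (p n)) atTop (𝓝 0) :=
      Real.isLittleO_log_id_atTop.tendsto_div_nhds_zero.comp hl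
    simpa using (h1.const_sub 4).sub (hl.const_div_atTop y)
  have hns : ∀ᶠ n : ℕ in atTop, n * s n = Real.log (p n) *
      (4 - Real.log (Real.log (p n)) / Real.log (p n) - y / Real.log (p n)) := by
    filter_upwards [hl0, eventually_gt_atTop 0] with n hln hn
    have hn' : (n : ℝ) ≠ 0 := by positivity
    rw [hs]
    field_simp
  have hinf : Tendsto (fun n : ℕ => n * s n) atTop atTop :=
    (hl.atTop_mul_pos (by norm_num) hb).congr' (hns.mono fun n h => h.symm)
  have h0 : Tendsto s atTop (𝓝 0) := by
    have := hlog.mul hb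
    rw [zero_mul] at this
    refine this.congr' ?_
    filter_upwards [hns, eventually_gt_atTop 0] with n h hn
    have hn' : (n : ℝ) ≠ 0 := by positivity
    rw [div_mul_eq_mul_div, ← h, mul_div_cancel_left₀ _ hn']
  have hpos : ∀ᶠ n in atTop, 0 < s n := by
    filter_upwards [hinf.eventually_gt_atTop 0] with n hn
    exact pos_of_mul_pos_right hn (Nat.cast_nonneg n)
  refine ⟨hpos, ?_⟩
  have hkey := ((tendsto_corrTail hpos h0 hinf).mul ((hb.inv₀ four_ne_zero).sqrt)).mul_const
    (Real.exp (y / 2))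
  have hconst : (√(Real.pi / (1 / 2)) / 2)⁻¹ * √(4⁻¹) * Real.exp (y / 2)
      = 2 * (1 / √(8 * Real.pi) * Real.exp (y / 2)) := by
    have h4 : √(4 : ℝ) = 2 := by rw [show (4 : ℝ) = 2 ^ 2 by norm_num]; exact Real.sqrt_sq two_pos.le
    have h8 : √(8 * Real.pi) = 2 * √(Real.pi / (1 / 2)) := by
      rw [show 8 * Real.pi = 4 * (Real.pi / (1 / 2)) by ring, Real.sqrt_mul (by norm_num), h4]
    rw [h8, Real.sqrt_inv, h4]
    field_simp
  rw [hconst] at hkey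
  refine hkey.congr' ?_
  filter_upwards [hns, hl0, hinf.eventually_gt_atTop 0, hpos, eventually_gt_atTop 0,
    hp.eventually_gt_atTop 0] with n h hln hnspos hsn hn hpn
  have hn' : (n : ℝ) ≠ 0 := by positivity
  have hpn' : (0 : ℝ) < p n := by exact_mod_cast hpn
  have hr : √(n * s n) * √(4 - Real.log (Real.log (p n)) / Real.log (p n) - y / Real.log (p n))⁻¹
      = √(Real.log (p n)) := by
    rw [← Real.sqrt_mul hnspos.le, h]
    congr 1
    refine mul_inv_cancel_right₀ (fun h' => ?_) _
    rw [h', mul_zero] at h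
    exact hnspos.ne' h
  -- The reason for the centring 4 log p - log log p: e^(ns/2) is p² (log p)^(-1/2) e^(-y/2), and
  -- the factor √(ns) restores √(log p) up to a constant.
  have hexp : Real.exp (n * s n / 2) * √(Real.log (p n)) * Real.exp (y / 2) = (p n : ℝ) ^ 2 := by
    rw [← Real.exp_log (Real.sqrt_pos.2 hln), ← Real.exp_log (pow_pos hpn' 2), ← Real.exp_add,
      ← Real.exp_add, Real.log_sqrt hln.le, Real.log_pow, hs, mul_div_cancel₀ _ hn']
    congr 1
    push_cast
    ring
  rw [← hexp, ← hr]
  ring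

lemma tendsto_choose_two_div_sq {p : ℕ → ℕ} (hp : Tendsto p atTop atTop) :
    Tendsto (fun n => ((p n).choose 2 : ℝ) / (p n : ℝ) ^ 2) atTop (𝓝 (1 / 2)) := by
  have h1 : Tendsto (fun n => (1 - ((p n : ℝ))⁻¹) / 2) atTop (𝓝 (1 / 2)) := by
    simpa using ((tendsto_inv_atTop_nhds_zero_nat (𝕜 := ℝ)).comp hp).const_sub 1 |>.div_const 2
  refine h1.congr' ?_
  filter_upwards [hp.eventually_gt_atTop 0] with n hn
  have hn' : (p n : ℝ) ≠ 0 := by positivity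
  rw [Nat.cast_choose_two]
  field_simp

/-- Above the level `√(1 - exp (-s))`, the coherence and its logarithmic transform agree. -/
lemma le_coherence_iff_log_le {c s : ℝ} (hc0 : 0 ≤ c) (hc1 : c < 1) :
    √(1 - Real.exp (-s)) ≤ c ↔ Real.log (1 - c ^ 2) ≤ -s := by
  have h1 : 0 < 1 - c ^ 2 := by nlinarith
  rw [Real.sqrt_le_left hc0, Real.log_le_iff_le_exp h1]
  constructor <;> intro h <;> linarith

section Main

variable {Ω : ℕ → Type*} [∀ n, MeasurableSpace (Ω n)] {P : ∀ n, Measure (Ω n)}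
  [∀ n, IsProbabilityMeasure (P n)] {p : ℕ → ℕ} {X : ∀ n, Fin (p n) → Ω n → Fin n → ℝ}

lemma tendsto_measure_le_coherence_zero (hp : ∀ n, 1 ≤ n → 2 ≤ p n)
    (hX : ∀ n, 1 ≤ n → IIDSphericalColumns (P n) (X n))
    (hlog : Tendsto (fun n : ℕ => Real.log (p n) / n) atTop (𝓝 0)) {ε : ℝ} (hε : 0 < ε) :
    Tendsto (fun n => P n {ω | ε ≤ |coherence (fun j => X n j ω)|}) atTop (𝓝 0) := by
  -- The level is capped below 1, where the tail formula applies.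
  set t := min ε (1 / 2) with ht
  have ht0 : 0 < t := lt_min hε (by norm_num)
  have ht1 : t < 1 := (min_le_right _ _).trans_lt (by norm_num)
  have hlim := ENNReal.tendsto_ofReal (tendsto_sq_mul_corrTail_zero hp hlog ht0 ht1)
  rw [ENNReal.ofReal_zero] at hlim
  refine tendsto_of_tendsto_of_tendsto_of_le_of_le' tendsto_const_nhds hlim
    (Eventually.of_forall fun _ => zero_le) ?_
  filter_upwards [eventually_ge_atTop 3] with n hn
  refine (measure_mono (t := {ω | t ≤ coherence (fun j => X n j ω)}) fun ω hω => ?_).trans ?_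
  · have h : ε ≤ |coherence (fun j => X n j ω)| := hω
    rw [abs_of_nonneg (coherence_nonneg _)] at h
    exact (min_le_left _ _).trans h
  · rw [← ofReal_measureReal]
    exact ENNReal.ofReal_le_ofReal
      ((hX n (by omega)).measureReal_le_coherence_le hn (hp n (by omega)) ht0.le ht1)

lemma tendsto_measureReal_log_coherence_le (hp : ∀ n, 1 ≤ n → 2 ≤ p n)
    (hX : ∀ n, 1 ≤ n → IIDSphericalColumns (P n) (X n))
    (hlog : Tendsto (fun n : ℕ => Real.log (p n) / n) atTop (𝓝 0)) (hinf : Tendsto p atTop atTop)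
    (y : ℝ) :
    Tendsto (fun n : ℕ => (P n).real {ω |
      (n : ℝ) * Real.log (1 - coherence (fun j => X n j ω) ^ 2)
        + 4 * Real.log (p n) - Real.log (Real.log (p n)) ≤ y}) atTop
      (𝓝 (1 - Real.exp (-(1 / √(8 * Real.pi)) * Real.exp (y / 2)))) := by
  let s : ℕ → ℝ := fun n => (4 * Real.log (p n) - Real.log (Real.log (p n)) - y) / n
  obtain ⟨hpos, hq⟩ := tendsto_sq_mul_corrTail_critical hlog hinf y (s := s) fun _ => rfl
  set t : ℕ → ℝ := fun n => √(1 - Real.exp (-s n)) with ht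
  have ht0 : ∀ n, 0 ≤ t n := fun n => Real.sqrt_nonneg _
  have ht1 : ∀ n, t n < 1 := fun n => by
    rw [ht, Real.sqrt_lt' one_pos]
    linarith [Real.exp_pos (-s n)]
  have hpinf : Tendsto (fun n => (p n : ℝ)) atTop atTop := tendsto_natCast_atTop_atTop.comp hinf
  have herr : Tendsto (fun n => 8 * (p n : ℝ) ^ 3 * corrTail n (t n) ^ 2) atTop (𝓝 0) := by
    -- Write p³q² as (p²q)² / p, with p²q convergent.
    have h1 := ((hq.pow 2).const_mul 8).mul hpinf.inv_tendsto_atTop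
    rw [mul_zero] at h1
    refine h1.congr' ?_
    filter_upwards [hinf.eventually_gt_atTop 0] with n hn
    have hn' : (p n : ℝ) ≠ 0 := by positivity
    simp only [Pi.inv_apply, ht]
    field_simp
  have hexp : Tendsto (fun n => Real.exp (-(((p n).choose 2 : ℕ) * corrTail n (t n)))) atTop
      (𝓝 (Real.exp (-(1 / √(8 * Real.pi)) * Real.exp (y / 2)))) := by
    have h1 := ((tendsto_choose_two_div_sq hinf).mul hq).neg.rexp
    have h2 : -(1 / 2 * (2 * (1 / √(8 * Real.pi) * Real.exp (y / 2))))
        = -(1 / √(8 * Real.pi)) * Real.exp (y / 2) := by ring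
    rw [h2] at h1
    refine h1.congr' ?_
    filter_upwards [hinf.eventually_gt_atTop 0] with n hn
    have hn' : (p n : ℝ) ≠ 0 := by positivity
    simp only [ht]
    congr 2
    field_simp
  have hlt : Tendsto (fun n => (P n).real {ω | coherence (fun j => X n j ω) < t n}) atTop
      (𝓝 (Real.exp (-(1 / √(8 * Real.pi)) * Real.exp (y / 2)))) := by
    refine tendsto_of_tendsto_of_dist hexp (squeeze_zero' (Eventually.of_forall fun _ =>
      dist_nonneg) ?_ herr)
    filter_upwards [eventually_ge_atTop 3] with n hn
    rw [dist_comm, Real.dist_eq]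
    exact (hX n (by omega)).abs_measureReal_coherence_lt_sub_exp_le hn (hp n (by omega))
      (ht0 n) (ht1 n)
  refine (hlt.const_sub 1).congr' ?_
  filter_upwards [eventually_ge_atTop 3] with n hn
  have hXn := hX n (by omega)
  have hm : Measurable fun ω => coherence fun j => X n j ω := measurable_coherence hXn.measurable
  have hn' : (0 : ℝ) < n := by exact_mod_cast (by omega : 0 < n)
  rw [← probReal_compl_eq_one_sub (measurableSet_lt hm measurable_const)]
  refine measureReal_congr ?_
  -- Coherence 1 would put the logarithm at 0, where its conventional value breaks the equivalence;
  -- this event is null.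
  have hnull : P n {ω | 1 ≤ coherence fun j => X n j ω} = 0 :=
    (measureReal_eq_zero_iff (measure_ne_top _ _)).1
      (hXn.measureReal_one_le_coherence hn (hp n (by omega)))
  filter_upwards [measure_eq_zero_iff_ae_notMem.1 hnull] with ω hω
  have hω1 : coherence (fun j => X n j ω) < 1 := not_le.1 hω
  refine propext ?_
  change ¬ (coherence (fun j => X n j ω) < t n) ↔ (n : ℝ) *
    Real.log (1 - coherence (fun j => X n j ω) ^ 2)
        + 4 * Real.log (p n) - Real.log (Real.log (p n)) ≤ y
  rw [not_lt, ht, le_coherence_iff_log_le (coherence_nonneg _) hω1, ← neg_div, le_div_iff₀ hn']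
  constructor <;> intro h <;> linarith

end Main

theorem mainTheorem1
    {Ω : ℕ → Type*} [∀ n, MeasurableSpace (Ω n)]
    (P : ∀ n, Measure (Ω n)) [∀ n, IsProbabilityMeasure (P n)]
    (p : ℕ → ℕ) (hp : ∀ n, 1 ≤ n → 2 ≤ p n)
    (X : ∀ n, Fin (p n) → Ω n → Fin n → ℝ)
    (hX : ∀ n, 1 ≤ n → IIDSphericalColumns (P n) (X n))
    (hlog : Tendsto (fun n : ℕ => Real.log (p n) / n) atTop (𝓝 0)) :
    (∀ ε : ℝ, 0 < ε →
      Tendsto (fun n => P n {ω | ε ≤ |coherence (fun j => X n j ω)|}) atTop (𝓝 0)) ∧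
    (Tendsto p atTop atTop →
      ∃ ν : ProbabilityMeasure ℝ,
        (∀ y : ℝ, cdf (ν : Measure ℝ) y
          = 1 - Real.exp (-(1 / √(8 * Real.pi)) * Real.exp (y / 2))) ∧
        TendstoInDistribution
          (fun (n : ℕ) (ω : Ω n) =>
            (n : ℝ) * Real.log (1 - coherence (fun j => X n j ω) ^ 2)
              + 4 * Real.log (p n) - Real.log (Real.log (p n)))
          atTop (id : ℝ → ℝ) P (ν : Measure ℝ)) := by
  refine ⟨fun ε hε => tendsto_measure_le_coherence_zero hp hX hlog hε, fun hinf => ?_⟩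
  obtain ⟨ν, hν⟩ := exists_cdf_eq_one_sub_exp (K := 1 / √(8 * Real.pi)) (by positivity)
  refine ⟨ν, hν, tendstoInDistribution_of_tendsto_cdf (fun n => ?_) fun y => ?_⟩
  · have hm : Measurable fun ω => coherence fun j => X n j ω := by
      -- Nothing is assumed at n = 0, but there the columns take values in a one-point space.
      rcases Nat.eq_zero_or_pos n with rfl | hn
      · exact measurable_coherence fun j => measurable_of_subsingleton_codomain _
      · exact measurable_coherence (hX n hn).measurable
    exact ((((((hm.pow_const 2).const_sub 1).log).const_mul _).add_const _).sub_const _).aemeasurable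
  · rw [hν]
    exact tendsto_measureReal_log_coherence_le hp hX hlog hinf y
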